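/- Let $d\ge 2$ and let $\Omega\subsetneq\mathbb R^d$ be a Lipschitz domain, bounded or unbounded. That is, $\Omega$ is non-empty, open and connected, and there are $\varepsilon>0$, $N\in\mathbb N$, $M>0$ and a countable family $\{U_j\}$ of open sets such that: (i) for each $x\in\partial\Omega$ the ball $B_\varepsilon(x)$ is contained in some $U_j$; (ii) no point lies in more than $N$ of the $U_j$; (iii) for each $j$ one has $U_j\cap\Omega=U_j\cap\Omega_j$, where in some Cartesian coordinate system $\Omega_j=\{(y,t): y\in\mathbb R^{d-1},\ t>\varphi_j(y)\}$ with $\varphi_j:\mathbb R^{d-1}\to\mathbb R$ Lipschitz with constant $M$. Let $H^1(\Omega)$ be the complex Sobolev space with norm $\|f\|_1^2=\|\nabla f\|^2_{L^2(\Omega;\mathbb C^d)}+\|f\|^2_{L^2(\Omega)}$. An extension operator is a bounded linear operator $E:H^1(\Omega)\to H^1(\mathbb R^d)$ with $(Ef)|_\Omega=f$ for all $f$; let $\|E\|_1$ be its operator norm, and let $\mathcal E(\Omega):=\inf_E\|E\|_1\in[0,\infty]$, the infimum being over all extension operators. For $\beta\ge 0$ let $F_\Omega(\beta):=\inf\sigma(-\Delta_\beta^\Omega)$,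 where $-\Delta^\Omega_\beta$ is the self-adjoint Robin Laplacian in $L^2(\Omega)$ associated by the first representation theorem with the form $$(\nabla f,\nabla g)_{L^2(\Omega;\mathbb C^d)}-\beta\,(f|_{\partial\Omega},g|_{\partial\Omega})_{L^2(\partial\Omega)},\qquad f,g\in H^1(\Omega).$$ For $\alpha\ge 0$ let $F_{\partial\Omega}(\alpha):=\inf\sigma(-\Delta^{\partial\Omega}_\alpha)$, where $-\Delta_\alpha^{\partial\Omega}$ is the self-adjoint Schrödinger operator in $L^2(\mathbb R^d)$ with $\delta$-interaction of strength $\alpha$ on $\partial\Omega$, associated with the form $$(\nabla f,\nabla g)_{L^2(\mathbb R^d;\mathbb C^d)}-\alpha\,(f|_{\partial\Omega},g|_{\partial\Omega})_{L^2(\partial\Omega)},\qquad f,g\in H^1(\mathbb R^d).$$ Here $f|_{\partial\Omega}$ denotes the trace and $L^2(\partial\Omega)$ is taken with respect to the surface measure. Then the equation $F_\Omega(\beta)=-1$ has a unique solution $\beta(\Omega)>0$, the equation $F_{\partial\Omega}(\alpha)=-1$ has a unique solution $\alpha(\partial\Omega)>0$, and $$\mathcal E(\Omega)\ \ge\ \sqrt{\frac{\alpha(\partial\Omega)}{\beta(\Omega)}}.$$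 -/

import Mathlib

open MeasureTheory Set Filter Topology
open scoped NNReal ENNReal ContDiff

noncomputable section

namespace SobolevExtension

/-- Euclidean space `ℝ^d`. -/
abbrev RSpace (d : ℕ) : Type := EuclideanSpace ℝ (Fin d)

/-- The `i`-th partial derivative of a function on `ℝ^d`. -/
def partialDeriv {d : ℕ} {F : Type*} [NormedAddCommGroup F] [NormedSpace ℝ F]
    (i : Fin d) (φ : RSpace d → F) (x : RSpace d) : F :=
  fderiv ℝ φ x (EuclideanSpace.single i 1)

/-- The classical gradient of a complex-valued function on `ℝ^d`, with values in `ℂ^d`. -/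
def classicalGrad {d : ℕ} (φ : RSpace d → ℂ) (x : RSpace d) : EuclideanSpace ℂ (Fin d) :=
  WithLp.toLp 2 fun i => partialDeriv i φ x

/-! ### Lipschitz domains -/

/-- `D = {(y, t) : y ∈ ℝ^(d-1), t > φ y}` in some Cartesian coordinate system of `ℝ^d`, where
`φ` is Lipschitz with constant `M` (that is, `φ` is Lipschitz and `‖∇φ‖_∞ ≤ M`). -/
def IsSpecialLipschitzDomain {d : ℕ} (M : ℝ≥0) (D : Set (RSpace d)) : Prop :=
  ∃ (e : RSpace d ≃ᵃⁱ[ℝ] WithLp 2 (RSpace (d - 1) × ℝ)) (φ : RSpace (d - 1) → ℝ),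
    LipschitzWith M φ ∧ D = {x | φ (e x).fst < (e x).snd}

/-- Lipschitz (minimally smooth) domains in `ℝ^d`, bounded or unbounded. A countable family of
open sets is written as a sequence; the empty set may be used for padding. -/
def IsLipschitzDomain {d : ℕ} (Ω : Set (RSpace d)) : Prop :=
  IsOpen Ω ∧ IsConnected Ω ∧
    ∃ (ε : ℝ) (N : ℕ) (M : ℝ≥0) (U : ℕ → Set (RSpace d)), 0 < ε ∧ (∀ j, IsOpen (U j)) ∧
      (∀ x ∈ frontier Ω, ∃ j, Metric.ball x ε ⊆ U j) ∧
      (∀ x, {j | x ∈ U j}.encard ≤ N) ∧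
      (∀ j, ∃ D : Set (RSpace d), IsSpecialLipschitzDomain M D ∧ U j ∩ Ω = U j ∩ D)

/-! ### The Sobolev space `H¹(U)` -/

/-- The complex Hilbert space `L²(U)`. -/
abbrev L2 {d : ℕ} (U : Set (RSpace d)) : Type := Lp ℂ 2 (volume.restrict U)

/-- The complex Hilbert space `L²(U; ℂ^d)`. -/
abbrev L2Vec {d : ℕ} (U : Set (RSpace d)) : Type :=
  Lp (EuclideanSpace ℂ (Fin d)) 2 (volume.restrict U)

/-- `G` is the weak gradient of `f` on `U`:
`∫_U f ∂ᵢφ = - ∫_U Gᵢ φ` for every `i` and every test function `φ ∈ C_c^∞(U)`. -/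
def IsWeakGrad {d : ℕ} (U : Set (RSpace d)) (f : RSpace d → ℂ)
    (G : RSpace d → EuclideanSpace ℂ (Fin d)) : Prop :=
  ∀ φ : RSpace d → ℝ, ContDiff ℝ ∞ φ → HasCompactSupport φ → tsupport φ ⊆ U →
    ∀ i, ∫ x in U, partialDeriv i φ x • f x = - ∫ x in U, φ x • G x i

theorem integrable_smul_of_memLp {d : ℕ} {μ : Measure (RSpace d)} [IsLocallyFiniteMeasure μ]
    {g : RSpace d → ℝ} {f : RSpace d → ℂ} (hg : Continuous g) (hgc : HasCompactSupport g)
    (hf : MemLp f 2 μ) : Integrable (fun x => g x • f x) μ :=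
  (hf.locallyIntegrable one_le_two).integrable_smul_left_of_hasCompactSupport hg hgc

theorem continuous_partialDeriv {d : ℕ} {φ : RSpace d → ℝ} (h : ContDiff ℝ ∞ φ) (i : Fin d) :
    Continuous (partialDeriv i φ) :=
  (h.continuous_fderiv (by simp)).clm_apply continuous_const

theorem hasCompactSupport_partialDeriv {d : ℕ} {φ : RSpace d → ℝ} (h : HasCompactSupport φ)
    (i : Fin d) : HasCompactSupport (partialDeriv i φ) :=
  h.fderiv_apply ℝ _

theorem memLp_coord {d : ℕ} {μ : Measure (RSpace d)}
    {G : RSpace d → EuclideanSpace ℂ (Fin d)} (hG : MemLp G 2 μ) (i : Fin d) :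
    MemLp (fun x => G x i) 2 μ :=
  (EuclideanSpace.proj (𝕜 := ℂ) i).comp_memLp' hG

/-- The Sobolev space `H¹(U)`. Since the weak gradient of a function on an open set is unique,
`H¹(U)` is realised as the space of pairs `(f, ∇f)` with `f ∈ L²(U)` and weak gradient
`∇f ∈ L²(U; ℂ^d)`; the inherited norm is `‖f‖₁² = ‖f‖²_{L²(U)} + ‖∇f‖²_{L²(U;ℂ^d)}`. -/
def H1 {d : ℕ} (U : Set (RSpace d)) : Submodule ℂ (WithLp 2 (L2 U × L2Vec U)) where
  carrier := {p | IsWeakGrad U p.fst p.snd}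
  zero_mem' := by
    intro φ _ _ _ i
    have h1 : ∫ x in U, partialDeriv i φ x • (0 : L2 U) x = 0 := by
      apply integral_eq_zero_of_ae
      filter_upwards [Lp.coeFn_zero ℂ 2 (volume.restrict U)] with x hx
      have hx' : (0 : L2 U) x = 0 := hx
      rw [hx', smul_zero, Pi.zero_apply]
    have h2 : ∫ x in U, φ x • ((0 : L2Vec U) x) i = 0 := by
      apply integral_eq_zero_of_ae
      filter_upwards [Lp.coeFn_zero (EuclideanSpace ℂ (Fin d)) 2 (volume.restrict U)] with x hx
      have hx' : (0 : L2Vec U) x = 0 := hx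
      rw [hx', PiLp.zero_apply, smul_zero, Pi.zero_apply]
    change ∫ x in U, partialDeriv i φ x • (0 : L2 U) x
      = - ∫ x in U, φ x • ((0 : L2Vec U) x) i
    rw [h1, h2, neg_zero]
  add_mem' := by
    intro p q hp hq φ h1 h2 h3 i
    have e1 : ∫ x in U, partialDeriv i φ x • (p + q).fst x
        = (∫ x in U, partialDeriv i φ x • p.fst x) + ∫ x in U, partialDeriv i φ x • q.fst x := by
      rw [← integral_add
        (integrable_smul_of_memLp (continuous_partialDeriv h1 i)
          (hasCompactSupport_partialDeriv h2 i) (Lp.memLp _))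
        (integrable_smul_of_memLp (continuous_partialDeriv h1 i)
          (hasCompactSupport_partialDeriv h2 i) (Lp.memLp _))]
      apply integral_congr_ae
      filter_upwards [Lp.coeFn_add p.fst q.fst] with x hx
      have hx' : (p + q).fst x = p.fst x + q.fst x := hx
      rw [hx', smul_add]
    have e2 : ∫ x in U, φ x • (p + q).snd x i
        = (∫ x in U, φ x • p.snd x i) + ∫ x in U, φ x • q.snd x i := by
      rw [← integral_add
        (integrable_smul_of_memLp h1.continuous h2 (memLp_coord (Lp.memLp _) i))
        (integrable_smul_of_memLp h1.continuous h2 (memLp_coord (Lp.memLp _) i))]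
      apply integral_congr_ae
      filter_upwards [Lp.coeFn_add p.snd q.snd] with x hx
      have hx' : (p + q).snd x = p.snd x + q.snd x := hx
      rw [hx', PiLp.add_apply, smul_add]
    rw [e1, e2, hp φ h1 h2 h3 i, hq φ h1 h2 h3 i]
    ring
  smul_mem' := by
    intro c p hp φ h1 h2 h3 i
    have e1 : ∫ x in U, partialDeriv i φ x • (c • p).fst x
        = c * ∫ x in U, partialDeriv i φ x • p.fst x := by
      rw [← integral_const_mul]
      apply integral_congr_ae
      filter_upwards [Lp.coeFn_smul c p.fst] with x hx
      have hx' : (c • p).fst x = c * p.fst x := hx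
      rw [hx', mul_smul_comm]
    have e2 : ∫ x in U, φ x • (c • p).snd x i = c * ∫ x in U, φ x • p.snd x i := by
      rw [← integral_const_mul]
      apply integral_congr_ae
      filter_upwards [Lp.coeFn_smul c p.snd] with x hx
      have hx' : (c • p).snd x = c • p.snd x := hx
      rw [hx', PiLp.smul_apply, smul_eq_mul, mul_smul_comm]
    rw [e1, e2, hp φ h1 h2 h3 i]
    ring

/-- The underlying `L²` function of an element of `H¹(U)`. -/
def fn {d : ℕ} {U : Set (RSpace d)} (f : H1 U) : L2 U := f.1.fst

/-- The weak gradient of an element of `H¹(U)`. -/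
def grad {d : ℕ} {U : Set (RSpace d)} (f : H1 U) : L2Vec U := f.1.snd

/-! ### Extension operators -/

/-- `E : H¹(Ω) → H¹(ℝ^d)`, bounded and linear, is an extension operator: `(E f)|_Ω = f`. -/
def IsExtensionOperator {d : ℕ} {Ω : Set (RSpace d)}
    (E : H1 Ω →L[ℂ] H1 (univ : Set (RSpace d))) : Prop :=
  ∀ f : H1 Ω, fn (E f) =ᵐ[volume.restrict Ω] fn f

/-- The infimum of the norms `‖E‖₁` over all extension operators `E` for `Ω`, as an element of
`[0, ∞]` (so it is `∞` if there is no extension operator). -/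
def minExtensionNorm {d : ℕ} (Ω : Set (RSpace d)) : ℝ≥0∞ :=
  ⨅ (E : H1 Ω →L[ℂ] H1 (univ : Set (RSpace d))) (_ : IsExtensionOperator E), ‖E‖ₑ

/-! ### Traces -/

/-- The surface measure on a hypersurface `S` in `ℝ^d`: the `(d-1)`-dimensional Hausdorff measure
on `S`, normalised so as to agree with Lebesgue measure on `ℝ^(d-1)`. -/
def surfaceMeasure {d : ℕ} (S : Set (RSpace d)) : Measure (RSpace d) :=
  (μHE[d - 1] : Measure (RSpace d)).restrict S

/-- The space `L²(S)` over the surface measure. -/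
abbrev L2Surf {d : ℕ} (S : Set (RSpace d)) : Type := Lp ℂ 2 (surfaceMeasure S)

/-- `u ∈ L²(S)` is the trace on `S` of `f ∈ H¹(U)`: the pair `(f, u)` can be approximated in
`H¹(U) × L²(S)` by pairs `(φ|_U, φ|_S)` with `φ ∈ C_c^∞(ℝ^d)`. In other words, the trace is the
extension by continuity of the restriction `φ|_U ↦ φ|_S`. -/
def IsTrace {d : ℕ} (U S : Set (RSpace d)) (f : H1 U) (u : L2Surf S) : Prop :=
  ∀ ε : ℝ≥0∞, 0 < ε → ∃ φ : RSpace d → ℂ, ContDiff ℝ ∞ φ ∧ HasCompactSupport φ ∧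
    eLpNorm (fun x => fn f x - φ x) 2 (volume.restrict U) ≤ ε ∧
    eLpNorm (fun x => grad f x - classicalGrad φ x) 2 (volume.restrict U) ≤ ε ∧
    eLpNorm (fun x => u x - φ x) 2 (surfaceMeasure S) ≤ ε

/-! ### Operators and spectra -/

/-- The graph of the operator in `L²(U)` which the first representation theorem associates with
the sesquilinear form `t[f, g] = (∇f, ∇g)_{L²(U)} - γ (f|_S, g|_S)_{L²(S)}` on `H¹(U)`.
The pair `(F, h)` belongs to the graph if `F` is the `L²` function of some `f ∈ H¹(U)` with
`t[f, g] = (h, g)` for all `g ∈ H¹(U)`.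
(Mathlib's inner product is conjugate-linear in the first slot.) -/
def formOperatorGraph {d : ℕ} (U S : Set (RSpace d)) (γ : ℝ) : Set (L2 U × L2 U) :=
  {p | ∃ (f : H1 U) (u : L2Surf S), IsTrace U S f u ∧ fn f = p.1 ∧
    ∀ (g : H1 U) (v : L2Surf S), IsTrace U S g v →
      inner ℂ (grad g) (grad f) - (γ : ℂ) * inner ℂ v u = inner ℂ (fn g) p.2}

/-- The spectrum of the closed operator `T` in `H` with the given graph: `z` lies in the resolvent
set if `T - z` has a bounded everywhere defined inverse `R`, that is, if
`f ∈ dom T` and `(T - z) f = h` hold exactly when `f = R h`. -/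
def opSpectrum {H : Type*} [NormedAddCommGroup H] [NormedSpace ℂ H] (T : Set (H × H)) : Set ℂ :=
  {z | ¬ ∃ R : H →L[ℂ] H, ∀ f h : H, (f, h + z • f) ∈ T ↔ f = R h}

/-- The bottom of the (real) spectrum of a self-adjoint operator given by its graph. -/
def bottomSpectrum {H : Type*} [NormedAddCommGroup H] [NormedSpace ℂ H] (T : Set (H × H)) : ℝ :=
  sInf {r : ℝ | (r : ℂ) ∈ opSpectrum T}

/-- `F_Ω(β)`: the bottom of the spectrum of the Robin Laplacian `-Δ_β^Ω` in `L²(Ω)`. -/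
def robinBottom {d : ℕ} (Ω : Set (RSpace d)) (β : ℝ) : ℝ :=
  bottomSpectrum (formOperatorGraph Ω (frontier Ω) β)

/-- `F_{∂Ω}(α)`: the bottom of the spectrum of the Schrödinger operator in `L²(ℝ^d)` with
`δ`-interaction of strength `α` on `∂Ω`. -/
def deltaBottom {d : ℕ} (Ω : Set (RSpace d)) (α : ℝ) : ℝ :=
  bottomSpectrum (formOperatorGraph (univ : Set (RSpace d)) (frontier Ω) α)

end SobolevExtension

end

/-! By the variational principle, the bottom of the spectrum is at least `-1` exactly when `γ
‖f|_S‖² ≤ ‖∇f‖² + ‖f‖²` on the form domain. It equals `-1` exactly when `γ` is the largest such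
coupling. So `β(Ω)^(-1/2)` and `α(∂Ω)^(-1/2)` are the norms of the trace maps into `L²(∂Ω)` from the
form domain on `Ω` and from `H¹(ℝ^d)`. An extension `E f` has the same trace as `f`, hence `α
‖f|_∂Ω‖² ≤ ‖E f‖₁² ≤ ‖E‖² ‖f‖₁²`. Thus `α / ‖E‖²` is an admissible coupling on `Ω`, and `α / β ≤
‖E‖²`.

The analytic input is the trace inequality `‖f|_∂Ω‖² ≤ δ ‖∇f‖² + C_δ ‖f‖²` with `δ` arbitrarily
small (`IsLipschitzDomain.trace_inequality`). It makes the forms closed and semibounded for every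
coupling and gives a positive admissible coupling. A largest one exists because the boundary has
positive surface measure.

The form domain is realised as the closure of the triples `(φ, ∇φ, φ|_S)`, a Hilbert space `K` with
bounded maps `j`, `g`, `u` to its three components. The first representation theorem then reduces to
Lax–Milgram on `K` (`le_bottomSpectrum_iff`). Density of test functions in `H¹(Ω)` is never needed,
because only functions with a trace enter the form. Density in `H¹(ℝ^d)` is needed to give `E f` a
trace. It holds because an element orthogonal to all test functions solves `f - Δf = 0` weakly, and
`1 - Δ` is onto on the Schwartz space. -/

namespace SobolevExtension

/-! ### Bottom of the spectrum of an operator given by a closed form -/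

section FormOperators

variable {H : Type*} [NormedAddCommGroup H] [InnerProductSpace ℂ H] [CompleteSpace H]

/-- The spectrum of an operator whose resolvent at `-c` is the bounded operator `R`. -/
theorem mem_opSpectrum_iff_of_resolvent {T : Set (H × H)} {R : H →L[ℂ] H} {c : ℂ}
    (hR : ∀ f h : H, (f, h) ∈ T ↔ f = R (h + c • f)) (z : ℂ) :
    z ∈ opSpectrum T ↔ ¬ IsUnit (1 - (z + c) • R) := by
  have key : ∀ f h : H, (f, h + z • f) ∈ T ↔ (1 - (z + c) • R) f = R h := by
    intro f h
    rw [hR]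
    have : R (h + z • f + c • f) = R h + (z + c) • R f := by
      rw [add_assoc, ← add_smul, map_add, map_smul]
    rw [this]
    simp only [sub_apply, one_apply_eq_self,
      smul_apply]
    rw [sub_eq_iff_eq_add]
  unfold opSpectrum
  rw [mem_ofPred_eq, not_iff_not]
  simp only [key]
  constructor
  · rintro ⟨S, hS⟩
    rw [ContinuousLinearMap.isUnit_iff_bijective]
    constructor
    · rw [injective_iff_map_eq_zero]
      intro f hf
      have := (hS f 0).1 (by rw [hf, map_zero])
      rw [this, map_zero]
    · intro h
      -- This is the identity `(1 - w R)⁻¹ = 1 + w S` with `w = z + c`, where `S` is the resolvent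
      -- at `z`.
      refine ⟨h + (z + c) • S h, ?_⟩
      have := (hS (S h) h).2 rfl
      rw [map_add, map_smul, this]
      simp
  · rintro ⟨V, hV⟩
    refine ⟨(V⁻¹ : (H →L[ℂ] H)ˣ).1 * R, fun f h => ?_⟩
    rw [← hV]
    constructor
    · intro e
      rw [mul_apply_eq_comp, ← e, ← mul_apply_eq_comp, Units.inv_mul]
      rfl
    · intro e
      rw [e, mul_apply_eq_comp, ← mul_apply_eq_comp, Units.mul_inv]
      rfl

/-- The bottom of the spectrum of an operator whose resolvent at `-c` is a positive operator. -/
theorem bottomSpectrum_eq_of_resolvent {T : Set (H × H)} {R : H →L[ℂ] H} {c : ℝ}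
    (hpos : R.IsPositive) (hne : R ≠ 0)
    (hR : ∀ f h : H, (f, h) ∈ T ↔ f = R (h + (c : ℂ) • f)) :
    bottomSpectrum T = ‖R‖⁻¹ - c := by
  have hn : 0 < ‖R‖ := norm_pos_iff.2 hne
  have : Nontrivial H := by
    by_contra h
    rw [not_nontrivial_iff_subsingleton] at h
    exact hne (by ext x; exact Subsingleton.elim _ _)
  unfold bottomSpectrum
  refine IsLeast.csInf_eq ⟨?_, ?_⟩
  · rw [mem_ofPred_eq, mem_opSpectrum_iff_of_resolvent hR]
    have h0 : (0 : H →L[ℂ] H) ≤ R := (ContinuousLinearMap.nonneg_iff_isPositive R).2 hpos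
    -- A positive operator has its norm in its spectrum. This makes `‖R‖⁻¹ - c` a spectral point.
    have h1 := CStarAlgebra.norm_mem_spectrum_of_nonneg h0
    rw [spectrum.mem_iff] at h1
    intro hu
    apply h1
    have h2 : algebraMap ℝ (H →L[ℂ] H) ‖R‖ - R
        = (Units.mk0 (‖R‖ : ℂ) (by exact_mod_cast hn.ne')) •
          (1 - (((‖R‖⁻¹ - c : ℝ) : ℂ) + c) • R) := by
      ext x
      simp only [Units.smul_def, Units.val_mk0, sub_apply,
        smul_apply, one_apply_eq_self, smul_sub, smul_smul,
        Algebra.algebraMap_eq_smul_one]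
      have : (‖R‖ : ℂ) * (((‖R‖⁻¹ - c : ℝ) : ℂ) + c) = 1 := by
        push_cast
        rw [sub_add_cancel, mul_inv_cancel₀]
        exact_mod_cast hn.ne'
      rw [this, one_smul, Complex.coe_smul]
    rw [h2]
    exact hu.smul _
  · intro r hr
    rw [mem_ofPred_eq, mem_opSpectrum_iff_of_resolvent hR] at hr
    by_contra! hlt
    apply hr
    -- Below this point `1 - w R` is coercive with constant `1 - max w 0 * ‖R‖`. For negative `w`
    -- the term `-w R` is nonnegative and is dropped, hence the maximum.
    set w : ℝ := r + c with hw
    have hw1 : max w 0 * ‖R‖ < 1 := by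
      have : max w 0 < ‖R‖⁻¹ := max_lt (by linarith) (by positivity)
      calc max w 0 * ‖R‖ < ‖R‖⁻¹ * ‖R‖ := by gcongr
        _ = 1 := inv_mul_cancel₀ hn.ne'
    have hwc : ((r : ℂ) + c) = ((w : ℝ) : ℂ) := by rw [hw]; push_cast; rfl
    rw [hwc]
    refine ContinuousLinearMap.isUnit_of_forall_le_norm_inner_map _
      (c := ⟨1 - max w 0 * ‖R‖, by linarith⟩) (sub_pos.2 hw1) fun x => ?_
    change ‖x‖ ^ 2 * (1 - max w 0 * ‖R‖) ≤ _
    refine le_trans ?_ (Complex.re_le_norm _)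
    have e : (inner ℂ ((1 - (w : ℂ) • R) x) x : ℂ).re = ‖x‖ ^ 2 - w * (inner ℂ (R x) x : ℂ).re := by
      simp only [sub_apply, one_apply_eq_self,
        smul_apply, inner_sub_left, inner_smul_left, Complex.sub_re,
        Complex.conj_ofReal, Complex.re_ofReal_mul]
      congr 1
      exact inner_self_eq_norm_sq (𝕜 := ℂ) x
    rw [e]
    have h1 : 0 ≤ (inner ℂ (R x) x : ℂ).re := hpos.re_inner_nonneg_left x
    have h2 : (inner ℂ (R x) x : ℂ).re ≤ ‖R‖ * ‖x‖ ^ 2 := by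
      calc (inner ℂ (R x) x : ℂ).re ≤ ‖R x‖ * ‖x‖ :=
            (Complex.re_le_norm _).trans (norm_inner_le_norm _ _)
        _ ≤ ‖R‖ * ‖x‖ * ‖x‖ := by gcongr; exact R.le_opNorm x
        _ = _ := by ring
    have h3 : w * (inner ℂ (R x) x : ℂ).re ≤ max w 0 * (‖R‖ * ‖x‖ ^ 2) :=
      (mul_le_mul_of_nonneg_right (le_max_left _ _) h1).trans
        (mul_le_mul_of_nonneg_left h2 (le_max_right _ _))
    nlinarith

variable {K : Type*} [NormedAddCommGroup K] [InnerProductSpace ℂ K] [CompleteSpace K]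

open ContinuousLinearMap in
/-- The variational characterisation of the bottom of the spectrum of the operator which the first
representation theorem associates with a closed semibounded form. The form is `⟪k, B l⟫` on the
form domain `K`, which is mapped to `H` by `j`. -/
theorem le_bottomSpectrum_iff {j : K →L[ℂ] H} {B : K →L[ℂ] K} (hj : j ≠ 0)
    (hB : IsSelfAdjoint B) {c δ : ℝ} (hδ : 0 < δ)
    (hc : ∀ k, δ * ‖k‖ ^ 2 ≤ (inner ℂ k (B k)).re + c * ‖j k‖ ^ 2) {T : Set (H × H)}
    (hT : ∀ p : H × H, p ∈ T ↔ ∃ k, j k = p.1 ∧ ∀ l, inner ℂ l (B k) = inner ℂ (j l) p.2) (μ : ℝ) :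
    μ ≤ bottomSpectrum T ↔ ∀ k, μ * ‖j k‖ ^ 2 ≤ (inner ℂ k (B k)).re := by
  -- The shift by `c` makes the form coercive on `K`, so `A` is invertible by Lax–Milgram. The
  -- resolvent at `-c` is then `j A⁻¹ j*`.
  set A : K →L[ℂ] K := B + (c : ℂ) • (adjoint j ∘L j) with hA
  have hAsa : ∀ x y, inner ℂ (A x) y = inner ℂ x (A y) := by
    intro x y
    have h1 : inner ℂ (B x) y = inner ℂ x (B y) := by
      rw [← ContinuousLinearMap.adjoint_inner_left, hB.adjoint_eq]
    simp only [hA, add_apply, smul_apply,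
      ContinuousLinearMap.comp_apply, inner_add_left, inner_add_right, inner_smul_left,
      inner_smul_right, Complex.conj_ofReal, adjoint_inner_left, adjoint_inner_right, h1]
  have hAre : ∀ k, (inner ℂ k (A k)).re = (inner ℂ k (B k)).re + c * ‖j k‖ ^ 2 := by
    intro k
    simp only [hA, add_apply, smul_apply,
      ContinuousLinearMap.comp_apply, inner_add_right, inner_smul_right, adjoint_inner_right,
      Complex.add_re, Complex.re_ofReal_mul]
    congr 2
    exact inner_self_eq_norm_sq (𝕜 := ℂ) (j k)
  have hAco : ∀ k, δ * ‖k‖ ^ 2 ≤ (inner ℂ k (A k)).re := fun k => by rw [hAre]; exact hc k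
  have hAu : IsUnit A := by
    refine isUnit_of_forall_le_norm_inner_map A (c := ⟨δ, hδ.le⟩) hδ fun x => ?_
    change ‖x‖ ^ 2 * δ ≤ _
    rw [mul_comm, hAsa]
    exact (hAco x).trans (Complex.re_le_norm _)
  obtain ⟨V, hV⟩ := hAu
  set W : K →L[ℂ] K := (V⁻¹ : (K →L[ℂ] K)ˣ).1 with hW
  have hAW : ∀ x, A (W x) = x := fun x => by
    rw [← hV, hW, ← mul_apply_eq_comp, Units.mul_inv]; rfl
  have hWA : ∀ x, W (A x) = x := fun x => by
    rw [← hV, hW, ← mul_apply_eq_comp, Units.inv_mul]; rfl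
  set R : H →L[ℂ] H := j ∘L W ∘L adjoint j with hRdef
  have hR : ∀ f h : H, (f, h) ∈ T ↔ f = R (h + (c : ℂ) • f) := by
    intro f h
    rw [hT]
    have key : ∀ k, j k = f → ((∀ l, inner ℂ l (B k) = inner ℂ (j l) h) ↔
        A k = adjoint j (h + (c : ℂ) • f)) := by
      intro k hk
      rw [ext_iff_inner_left ℂ]
      refine forall_congr' fun l => ?_
      simp only [hA, add_apply, smul_apply,
        ContinuousLinearMap.comp_apply, inner_add_right, inner_smul_right, adjoint_inner_right,
        map_add, map_smul, hk, add_left_inj]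
    constructor
    · rintro ⟨k, hk, hl⟩
      have h1 := (key k hk).1 hl
      change f = j (W (adjoint j _))
      rw [← h1, hWA]
      exact hk.symm
    · intro hf
      refine ⟨W (adjoint j (h + (c : ℂ) • f)), hf.symm, (key _ hf.symm).2 (hAW _)⟩
  have hinner : ∀ x y, inner ℂ (R x) y = inner ℂ (W (adjoint j x)) (A (W (adjoint j y))) := by
    intro x y
    rw [hAW, adjoint_inner_right]
    rfl
  have hpos : R.IsPositive := by
    rw [isPositive_def']
    refine ⟨?_, fun x => ?_⟩
    · rw [ContinuousLinearMap.isSelfAdjoint_iff_isSymmetric]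
      intro x y
      have h1 := hinner x y
      have h2 := hinner y x
      rw [← hAsa] at h1
      change inner ℂ (R x) y = inner ℂ x (R y)
      rw [← inner_conj_symm x (R y), h2, h1, inner_conj_symm]
    · change 0 ≤ RCLike.re (inner ℂ (R x) x)
      rw [hinner]
      exact le_trans (by positivity) (hAco _)
  -- Cauchy–Schwarz for the form of `A`, applied to `k` and `l = A⁻¹ j* j k`, for which `⟪k, A l⟫ =
  -- ‖j k‖²`. It is obtained from the discriminant of the quadratic `t ↦ ⟪k - t l, A (k - t l)⟫`.
  have hRj : ∀ k, ‖j k‖ ^ 4 ≤ (inner ℂ k (A k)).re * (inner ℂ (R (j k)) (j k)).re := by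
    intro k
    set l := W (adjoint j (j k)) with hl
    have hb : inner ℂ k (A l) = ((‖j k‖ ^ 2 : ℝ) : ℂ) := by
      rw [hAW, adjoint_inner_right, inner_self_eq_norm_sq_to_K]
      push_cast
      rfl
    have hb' : inner ℂ l (A k) = ((‖j k‖ ^ 2 : ℝ) : ℂ) := by
      rw [← hAsa, ← inner_conj_symm, hb, Complex.conj_ofReal]
    rw [hinner]
    have h0 : ∀ t : ℝ, 0 ≤ (inner ℂ l (A l)).re * (t * t) + (-2 * ‖j k‖ ^ 2) * t
        + (inner ℂ k (A k)).re := by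
      intro t
      have h1 : 0 ≤ (inner ℂ (k - (t : ℂ) • l) (A (k - (t : ℂ) • l))).re :=
        le_trans (by positivity) (hAco _)
      simp only [map_sub, map_smul, inner_sub_left, inner_sub_right, inner_smul_left,
        inner_smul_right, hb, hb', Complex.conj_ofReal, Complex.sub_re, Complex.re_ofReal_mul,
        Complex.ofReal_re] at h1
      linarith
    have h2 := discrim_le_zero h0
    unfold discrim at h2
    linarith
  have hne : R ≠ 0 := by
    intro h0
    apply hj
    ext k
    have := hRj k
    rw [h0] at this
    simp only [zero_apply, inner_zero_left, Complex.zero_re, mul_zero] at this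
    have h4 : ‖j k‖ = 0 := by
      by_contra hne
      have : 0 < ‖j k‖ ^ 4 := by positivity
      linarith
    simpa using h4
  have hn : 0 < ‖R‖ := norm_pos_iff.2 hne
  rw [bottomSpectrum_eq_of_resolvent hpos hne hR]
  have hub : ∀ k, ‖j k‖ ^ 2 ≤ ‖R‖ * (inner ℂ k (A k)).re := by
    intro k
    have h2 : (inner ℂ (R (j k)) (j k)).re ≤ ‖R‖ * ‖j k‖ ^ 2 := by
      calc (inner ℂ (R (j k)) (j k)).re ≤ ‖R (j k)‖ * ‖j k‖ :=
            (Complex.re_le_norm _).trans (norm_inner_le_norm _ _)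
        _ ≤ ‖R‖ * ‖j k‖ * ‖j k‖ := by gcongr; exact R.le_opNorm _
        _ = _ := by ring
    have h3 : 0 ≤ (inner ℂ k (A k)).re := le_trans (by positivity) (hAco k)
    rcases (norm_nonneg (j k)).eq_or_lt with h0 | h0
    · rw [← h0]; simp only [ne_eq, OfNat.ofNat_ne_zero, not_false_eq_true, zero_pow]; positivity
    · have h4 : ‖j k‖ ^ 2 * ‖j k‖ ^ 2 ≤ (‖R‖ * (inner ℂ k (A k)).re) * ‖j k‖ ^ 2 := by
        calc ‖j k‖ ^ 2 * ‖j k‖ ^ 2 = ‖j k‖ ^ 4 := by ring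
          _ ≤ (inner ℂ k (A k)).re * (inner ℂ (R (j k)) (j k)).re := hRj k
          _ ≤ (inner ℂ k (A k)).re * (‖R‖ * ‖j k‖ ^ 2) := by gcongr
          _ = _ := by ring
      exact le_of_mul_le_mul_right h4 (by positivity)
  constructor
  · intro h k
    have h1 := hub k
    rw [hAre] at h1
    have h2 : ‖R‖⁻¹ * ‖j k‖ ^ 2 ≤ (inner ℂ k (B k)).re + c * ‖j k‖ ^ 2 := by
      rw [inv_mul_le_iff₀ hn]; exact h1
    nlinarith [sq_nonneg ‖j k‖]
  · intro h
    rcases le_or_gt (μ + c) 0 with hm | hm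
    · have : 0 < ‖R‖⁻¹ := by positivity
      linarith
    · have hle : ‖R‖ ≤ (μ + c)⁻¹ := by
        refine ContinuousLinearMap.opNorm_le_bound _ (by positivity) fun x => ?_
        -- Testing the form inequality at `A⁻¹ j* x`, which `j` maps to `R x`, gives `(μ + c) ‖R x‖²
        -- ≤ ‖R x‖ ‖x‖`.
        have h1 := h (W (adjoint j x))
        have h2 : (inner ℂ (W (adjoint j x)) (A (W (adjoint j x)))).re ≤ ‖R x‖ * ‖x‖ := by
          rw [← hinner]
          exact (Complex.re_le_norm _).trans (norm_inner_le_norm _ _)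
        rw [hAre] at h2
        change μ * ‖R x‖ ^ 2 ≤ _ at h1
        change _ + c * ‖R x‖ ^ 2 ≤ _ at h2
        rcases (norm_nonneg (R x)).eq_or_lt with h0 | h0
        · rw [← h0]; positivity
        · rw [← div_eq_inv_mul, le_div_iff₀ hm]
          have : ((‖R x‖ * (μ + c))) * ‖R x‖ ≤ ‖x‖ * ‖R x‖ := by nlinarith
          exact le_of_mul_le_mul_right this h0
      have := inv_anti₀ hn hle
      rw [inv_inv] at this
      linarith

end FormOperators

/-! ### The critical coupling of an abstract form -/

section CriticalCoupling

variable {H G S K : Type*} [NormedAddCommGroup H] [InnerProductSpace ℂ H]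
  [NormedAddCommGroup G] [InnerProductSpace ℂ G]
  [NormedAddCommGroup S] [InnerProductSpace ℂ S]
  [NormedAddCommGroup K] [InnerProductSpace ℂ K]
  {j : K →L[ℂ] H} {g : K →L[ℂ] G} {u : K →L[ℂ] S}

/-- The couplings `γ` for which `‖g k‖² - γ ‖u k‖² ≥ -‖j k‖²` for all `k`. -/
def admissibleCouplings (j : K →L[ℂ] H) (g : K →L[ℂ] G) (u : K →L[ℂ] S) : Set ℝ :=
  {γ | ∀ k, γ * ‖u k‖ ^ 2 ≤ ‖g k‖ ^ 2 + ‖j k‖ ^ 2}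

-- A relatively form-bounded perturbation with relative bound `0` keeps the form semibounded and
-- closed for every coupling, which is what the variational characterisation requires.
open ContinuousLinearMap in
theorem le_bottomSpectrum_iff_of_relativelyBounded
    [CompleteSpace H] [CompleteSpace G] [CompleteSpace S] [CompleteSpace K]
    (hnorm : ∀ k, ‖k‖ ^ 2 = ‖j k‖ ^ 2 + ‖g k‖ ^ 2 + ‖u k‖ ^ 2)
    (hrel : ∀ δ : ℝ, 0 < δ → ∃ C : ℝ, ∀ k, ‖u k‖ ^ 2 ≤ δ * ‖g k‖ ^ 2 + C * ‖j k‖ ^ 2)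
    (hu : u ≠ 0) {γ : ℝ} (hγ : 0 < γ) {T : Set (H × H)}
    (hT : ∀ p : H × H, p ∈ T ↔ ∃ k, j k = p.1 ∧
      ∀ l, inner ℂ (g l) (g k) - (γ : ℂ) * inner ℂ (u l) (u k) = inner ℂ (j l) p.2) (μ : ℝ) :
    μ ≤ bottomSpectrum T ↔ ∀ k, μ * ‖j k‖ ^ 2 ≤ ‖g k‖ ^ 2 - γ * ‖u k‖ ^ 2 := by
  set B : K →L[ℂ] K := adjoint g ∘L g - (γ : ℂ) • (adjoint u ∘L u) with hB
  have hBin : ∀ l k, inner ℂ l (B k)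
      = inner ℂ (g l) (g k) - (γ : ℂ) * inner ℂ (u l) (u k) := by
    intro l k
    simp only [hB, sub_apply, smul_apply, comp_apply, inner_sub_right, inner_smul_right,
      adjoint_inner_right]
  have hBre : ∀ k, (inner ℂ k (B k)).re = ‖g k‖ ^ 2 - γ * ‖u k‖ ^ 2 := by
    intro k
    rw [hBin, Complex.sub_re, Complex.re_ofReal_mul]
    congr 1
    · exact inner_self_eq_norm_sq (𝕜 := ℂ) (g k)
    · congr 1
      exact inner_self_eq_norm_sq (𝕜 := ℂ) (u k)
  have hBsa : IsSelfAdjoint B := by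
    rw [ContinuousLinearMap.isSelfAdjoint_iff_isSymmetric]
    intro x y
    change inner ℂ (B x) y = inner ℂ x (B y)
    rw [← inner_conj_symm, hBin, hBin, map_sub, map_mul, Complex.conj_ofReal, inner_conj_symm,
      inner_conj_symm]
  -- If `j` vanished, letting `δ → 0` in the relative bound would force `u = 0`.
  have hj : j ≠ 0 := by
    intro h0
    apply hu
    ext k
    have h1 : ∀ δ : ℝ, 0 < δ → ‖u k‖ ^ 2 ≤ δ * ‖g k‖ ^ 2 := by
      intro δ hδ
      obtain ⟨C, hC⟩ := hrel δ hδ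
      have := hC k
      simpa [h0] using this
    have h2 : ‖u k‖ ^ 2 ≤ 0 := by
      refine le_of_forall_pos_le_add fun ε hε => ?_
      refine (h1 (ε / (‖g k‖ ^ 2 + 1)) (by positivity)).trans ?_
      rw [zero_add, div_mul_eq_mul_div, div_le_iff₀ (by positivity)]
      nlinarith
    simpa using le_antisymm h2 (sq_nonneg _)
  -- This `δ` absorbs `(γ + 1) ‖u k‖²` into half of `‖g k‖²`. The extra `+ 1` controls the term `‖u
  -- k‖²` in the norm of `K`.
  obtain ⟨C, hC⟩ := hrel (1 / (2 * (γ + 1))) (by positivity)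
  have hco : ∀ k, 1 / 2 * ‖k‖ ^ 2
      ≤ (inner ℂ k (B k)).re + ((γ + 1) * C + 1 / 2) * ‖j k‖ ^ 2 := by
    intro k
    rw [hBre, hnorm]
    have h1 : (γ + 1) * ‖u k‖ ^ 2 ≤ 1 / 2 * ‖g k‖ ^ 2 + (γ + 1) * C * ‖j k‖ ^ 2 := by
      calc (γ + 1) * ‖u k‖ ^ 2
          ≤ (γ + 1) * (1 / (2 * (γ + 1)) * ‖g k‖ ^ 2 + C * ‖j k‖ ^ 2) := by gcongr; exact hC k
        _ = _ := by field_simp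
    nlinarith [sq_nonneg ‖u k‖]
  rw [le_bottomSpectrum_iff hj hBsa (by norm_num : (0 : ℝ) < 1 / 2) hco (T := T)
    (fun p => by simp only [hT, hBin]) μ]
  simp only [hBre]

/-- The bottom of the spectrum equals `-1` exactly at the largest admissible coupling. -/
theorem bottomSpectrum_eq_neg_one_iff
    [CompleteSpace H] [CompleteSpace G] [CompleteSpace S] [CompleteSpace K]
    (hnorm : ∀ k, ‖k‖ ^ 2 = ‖j k‖ ^ 2 + ‖g k‖ ^ 2 + ‖u k‖ ^ 2)
    (hrel : ∀ δ : ℝ, 0 < δ → ∃ C : ℝ, ∀ k, ‖u k‖ ^ 2 ≤ δ * ‖g k‖ ^ 2 + C * ‖j k‖ ^ 2)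
    (hu : u ≠ 0) {γ : ℝ} (hγ : 0 < γ) {T : Set (H × H)}
    (hT : ∀ p : H × H, p ∈ T ↔ ∃ k, j k = p.1 ∧
      ∀ l, inner ℂ (g l) (g k) - (γ : ℂ) * inner ℂ (u l) (u k) = inner ℂ (j l) p.2) :
    bottomSpectrum T = -1 ↔ IsGreatest (admissibleCouplings j g u) γ := by
  have key := le_bottomSpectrum_iff_of_relativelyBounded hnorm hrel hu hγ hT
  constructor
  · intro h
    refine ⟨fun k => ?_, fun γ' hγ' => ?_⟩
    · have := (key (-1)).1 h.ge k
      linarith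
    · by_contra! hlt
      -- A larger admissible `γ'` leaves the fraction `t` of `‖g k‖² + ‖j k‖²` unused at coupling
      -- `γ`, which lifts the bottom to at least `-1 + t`.
      set t : ℝ := 1 - γ / γ' with ht
      have hγ'0 : 0 < γ' := hγ.trans hlt
      have ht0 : 0 < t := by
        rw [ht, sub_pos, div_lt_one hγ'0]; exact hlt
      have : -1 + t ≤ bottomSpectrum T := by
        rw [key]
        intro k
        have h1 := hγ' k
        have h2 : γ * ‖u k‖ ^ 2 ≤ (1 - t) * (‖g k‖ ^ 2 + ‖j k‖ ^ 2) := by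
          have : γ * ‖u k‖ ^ 2 = γ / γ' * (γ' * ‖u k‖ ^ 2) := by field_simp
          rw [this, ht, sub_sub_cancel]
          gcongr
        nlinarith [sq_nonneg ‖g k‖]
      linarith
  · rintro ⟨hmem, hub⟩
    refine le_antisymm ?_ ((key (-1)).2 fun k => by have := hmem k; linarith)
    by_contra! hlt
    set η : ℝ := min 1 (bottomSpectrum T + 1) with hη
    have hη0 : 0 < η := lt_min one_pos (by linarith)
    have hη1 : η ≤ 1 := min_le_left _ _
    have h1 := (key (-1 + η)).1 (by
      have : η ≤ bottomSpectrum T + 1 := min_le_right _ _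
      linarith)
    obtain ⟨C, hC⟩ := hrel (1 / (2 * γ)) (by positivity)
    -- With a spectral gap `η` above `-1`, the convex combination of `h4` (weight `1 - t`) and `h3`
    -- (weight `t`) shows that `γ (1 + t)` is admissible. The choice of `t` lets `η` pay for the
    -- error `t * 2γ|C|`.
    set t : ℝ := min 1 (η / (2 * γ * |C| + 1)) with ht
    have ht0 : 0 < t := lt_min one_pos (by positivity)
    have ht1 : t ≤ 1 := min_le_left _ _
    have htC : t * (2 * γ * |C|) ≤ η := by
      have h2 : t ≤ η / (2 * γ * |C| + 1) := min_le_right _ _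
      rw [le_div_iff₀ (by positivity)] at h2
      nlinarith
    have : γ * (1 + t) ≤ γ := by
      refine hub fun k => ?_
      have h2 := h1 k
      have h3 : 2 * γ * ‖u k‖ ^ 2 ≤ ‖g k‖ ^ 2 + 2 * γ * |C| * ‖j k‖ ^ 2 := by
        calc 2 * γ * ‖u k‖ ^ 2
            ≤ 2 * γ * (1 / (2 * γ) * ‖g k‖ ^ 2 + |C| * ‖j k‖ ^ 2) := by
              gcongr
              refine (hC k).trans ?_
              gcongr
              exact le_abs_self C
          _ = _ := by field_simp
      have h4 : γ * ‖u k‖ ^ 2 ≤ ‖g k‖ ^ 2 + (1 - η) * ‖j k‖ ^ 2 := by linarith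
      have h5 := mul_le_mul_of_nonneg_left h3 ht0.le
      have h6 := mul_le_mul_of_nonneg_left h4 (sub_nonneg.2 ht1)
      have h7 : (t * (2 * γ * |C|)) * ‖j k‖ ^ 2 ≤ η * ‖j k‖ ^ 2 := by gcongr
      have h8 : (1 - t) * ((1 - η) * ‖j k‖ ^ 2) ≤ (1 - η) * ‖j k‖ ^ 2 := by
        have : 0 ≤ t * ((1 - η) * ‖j k‖ ^ 2) :=
          mul_nonneg ht0.le (mul_nonneg (by linarith) (sq_nonneg _))
        linarith
      linarith
    nlinarith

/-- The set of admissible couplings is closed, contains a positive number by the relative bound, and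
is bounded above by the quotient at any `k` with `u k ≠ 0`. -/
theorem exists_isGreatest_admissibleCouplings
    (hrel : ∀ δ : ℝ, 0 < δ → ∃ C : ℝ, ∀ k, ‖u k‖ ^ 2 ≤ δ * ‖g k‖ ^ 2 + C * ‖j k‖ ^ 2)
    (hu : u ≠ 0) : ∃ γ : ℝ, 0 < γ ∧ IsGreatest (admissibleCouplings j g u) γ := by
  obtain ⟨C, hC⟩ := hrel 1 one_pos
  have hmem : (1 / (|C| + 1)) ∈ admissibleCouplings j g u := by
    intro k
    rw [one_div, inv_mul_le_iff₀ (by positivity)]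
    have h1 := hC k
    have h2 : C * ‖j k‖ ^ 2 ≤ |C| * ‖j k‖ ^ 2 := by gcongr; exact le_abs_self C
    have h3 : 0 ≤ |C| * ‖g k‖ ^ 2 := by positivity
    nlinarith [sq_nonneg ‖j k‖]
  have hbdd : BddAbove (admissibleCouplings j g u) := by
    obtain ⟨k, hk⟩ : ∃ k, u k ≠ 0 := by
      by_contra! h
      exact hu (ContinuousLinearMap.ext h)
    have : 0 < ‖u k‖ ^ 2 := by positivity
    refine ⟨(‖g k‖ ^ 2 + ‖j k‖ ^ 2) / ‖u k‖ ^ 2, fun γ hγ => ?_⟩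
    rw [le_div_iff₀ this]
    exact hγ k
  have hclosed : IsClosed (admissibleCouplings j g u) := by
    have : admissibleCouplings j g u
        = ⋂ k, {γ : ℝ | γ * ‖u k‖ ^ 2 ≤ ‖g k‖ ^ 2 + ‖j k‖ ^ 2} := by
      ext γ
      simp [admissibleCouplings]
    rw [this]
    exact isClosed_iInter fun k => isClosed_le (by fun_prop) continuous_const
  exact ⟨_, lt_of_lt_of_le (by positivity) (le_csSup hbdd hmem), hclosed.csSup_mem ⟨_, hmem⟩ hbdd,
    fun γ hγ => le_csSup hbdd hγ⟩

/-- Comparison of the critical couplings of two forms, where the form domain of the second is mapped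
to that of the first with a loss of at most a factor `M`. -/
theorem critical_coupling_le_mul {H' G' K' : Type*}
    [NormedAddCommGroup H'] [InnerProductSpace ℂ H'] [NormedAddCommGroup G']
    [InnerProductSpace ℂ G'] [NormedAddCommGroup K'] [InnerProductSpace ℂ K']
    {j' : K' →L[ℂ] H'} {g' : K' →L[ℂ] G'} {u' : K' →L[ℂ] S} {α β M : ℝ}
    (hα0 : 0 < α) (hβ0 : 0 < β) (hα : IsGreatest (admissibleCouplings j g u) α)
    (hβ : IsGreatest (admissibleCouplings j' g' u') β) (hM : 0 ≤ M)
    (h : ∀ k', ∃ k, u k = u' k' ∧ ‖g k‖ ^ 2 + ‖j k‖ ^ 2 ≤ M * (‖g' k'‖ ^ 2 + ‖j' k'‖ ^ 2)) :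
    α / β ≤ M := by
  have h1 : ∀ k', α * ‖u' k'‖ ^ 2 ≤ M * (‖g' k'‖ ^ 2 + ‖j' k'‖ ^ 2) := by
    intro k'
    obtain ⟨k, hk, hk2⟩ := h k'
    rw [← hk]
    exact (hα.1 k).trans hk2
  rcases hM.eq_or_lt with h0 | h0
  -- For `M = 0` the map `u'` vanishes, so every coupling is admissible and none is largest.
  · exfalso
    have h2 : β + 1 ≤ β := by
      refine hβ.2 fun k' => ?_
      have h3 := h1 k'
      rw [← h0, zero_mul] at h3
      have h4 : ‖u' k'‖ ^ 2 = 0 := by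
        refine le_antisymm ?_ (sq_nonneg _)
        by_contra! hlt
        have : 0 < α * ‖u' k'‖ ^ 2 := by positivity
        linarith
      rw [h4, mul_zero]
      positivity
    linarith
  · have h2 : α / M ≤ β := by
      refine hβ.2 fun k' => ?_
      rw [div_mul_eq_mul_div, div_le_iff₀ h0, mul_comm _ M]
      exact h1 k'
    rw [div_le_iff₀ h0] at h2
    rw [div_le_iff₀ hβ0]
    linarith

end CriticalCoupling

/-! ### Surface measure on Lipschitz graphs -/

section Graph

variable {d : ℕ}

theorem _root_.LipschitzWith.euclideanHausdorffMeasure_image_le {X Y : Type*} [EMetricSpace X]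
    [MeasurableSpace X] [BorelSpace X] [EMetricSpace Y] [MeasurableSpace Y] [BorelSpace Y]
    {f : X → Y} {K : ℝ≥0} (hf : LipschitzWith K f) (n : ℕ) (s : Set X) :
    (μHE[n] : Measure Y) (f '' s) ≤ (K : ℝ≥0∞) ^ n * μHE[n] s := by
  simp only [Measure.euclideanHausdorffMeasure_def, Measure.smul_apply]
  have := hf.hausdorffMeasure_image_le (d := n) (by positivity) s
  rw [ENNReal.rpow_natCast] at this
  rw [ENNReal.smul_def, ENNReal.smul_def, smul_eq_mul, smul_eq_mul, mul_left_comm]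
  gcongr

/-- The parametrisation of the boundary of a special Lipschitz domain. -/
noncomputable def graphMap (e : RSpace d ≃ᵃⁱ[ℝ] WithLp 2 (RSpace (d - 1) × ℝ)) (ψ : RSpace (d - 1) → ℝ)
    (y : RSpace (d - 1)) : RSpace d :=
  e.symm (WithLp.toLp 2 (y, ψ y))

/-- The unit vector in the direction of the last coordinate. -/
noncomputable def verticalVec (e : RSpace d ≃ᵃⁱ[ℝ] WithLp 2 (RSpace (d - 1) × ℝ)) : RSpace d :=
  e.symm.linearIsometryEquiv (WithLp.toLp 2 (0, 1))

variable (e : RSpace d ≃ᵃⁱ[ℝ] WithLp 2 (RSpace (d - 1) × ℝ)) {ψ : RSpace (d - 1) → ℝ} {M : ℝ≥0}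

theorem norm_verticalVec : ‖verticalVec e‖ = 1 := by
  unfold verticalVec
  rw [LinearIsometryEquiv.norm_map, WithLp.prod_norm_eq_of_L2]
  simp

theorem symm_toLp_add (y : RSpace (d - 1)) (s t : ℝ) :
    e.symm (WithLp.toLp 2 (y, s + t)) = e.symm (WithLp.toLp 2 (y, s)) + t • verticalVec e := by
  unfold verticalVec
  have h := e.symm.map_vadd (WithLp.toLp 2 (y, s)) (t • WithLp.toLp 2 (0, 1))
  rw [map_smul, vadd_eq_add, vadd_eq_add, ← WithLp.toLp_smul, ← WithLp.toLp_add] at h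
  rw [add_comm (e.symm _), ← h]
  simp [add_comm]

theorem graphMap_add_smul_eq (y : RSpace (d - 1)) (t : ℝ) :
    graphMap e ψ y + t • verticalVec e = e.symm (WithLp.toLp 2 (y, ψ y + t)) := by
  rw [symm_toLp_add]; rfl

/-- The sharper constant `√(1 + M²)` is replaced by `1 + M`; only uniformity over the charts matters
later. -/
theorem lipschitzWith_graphMap (hψ : LipschitzWith M ψ) :
    LipschitzWith (1 + M) (graphMap e ψ) := by
  refine LipschitzWith.of_dist_le_mul fun x y => ?_
  unfold graphMap
  rw [AffineIsometryEquiv.dist_map, WithLp.prod_dist_eq_of_L2]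
  have h := hψ.dist_le_mul x y
  refine Real.sqrt_le_iff.2 ⟨by positivity, ?_⟩
  push_cast
  have h0 : (0 : ℝ) ≤ dist x y := dist_nonneg
  have h1 : (0 : ℝ) ≤ dist (ψ x) (ψ y) := dist_nonneg
  have h2 : 0 ≤ (M : ℝ) := M.2
  change dist x y ^ 2 + dist (ψ x) (ψ y) ^ 2 ≤ _
  calc dist x y ^ 2 + dist (ψ x) (ψ y) ^ 2 ≤ dist x y ^ 2 + (M * dist x y) ^ 2 := by gcongr
    _ ≤ _ := by nlinarith [mul_nonneg h2 (sq_nonneg (dist x y))]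

/-- Isometries preserve Hausdorff measure, which in full dimension and with this normalisation is
Lebesgue measure. -/
theorem measurePreserving_affineIsometryEquiv_symm : MeasurePreserving e.symm := by
  have h1 := e.symm.toIsometryEquiv.measurePreserving_euclideanHausdorffMeasure
    (Module.finrank ℝ (RSpace d))
  have h2 : Module.finrank ℝ (WithLp 2 (RSpace (d - 1) × ℝ)) = Module.finrank ℝ (RSpace d) :=
    e.symm.linearIsometryEquiv.toLinearEquiv.finrank_eq
  rw [InnerProductSpace.euclideanHausdorffMeasure_eq_volume] at h1
  rw [← h2, InnerProductSpace.euclideanHausdorffMeasure_eq_volume] at h1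
  exact h1

/-- Integration over `ℝ^d` by slices `y = const`, measured from the graph of `ψ`. -/
theorem lintegral_graph_slices {f : RSpace d → ℝ≥0∞} (hf : Measurable f) :
    ∫⁻ y, ∫⁻ t : ℝ, f (graphMap e ψ y + t • verticalVec e) = ∫⁻ x, f x := by
  have h1 : ∀ y, ∫⁻ t : ℝ, f (graphMap e ψ y + t • verticalVec e)
      = ∫⁻ t : ℝ, f (e.symm (WithLp.toLp 2 (y, t))) := by
    intro y
    simp_rw [graphMap_add_smul_eq]
    exact lintegral_add_left_eq_self (fun t => f (e.symm (WithLp.toLp 2 (y, t)))) (ψ y)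
  simp_rw [h1]
  have hm : MeasurePreserving (fun p : RSpace (d - 1) × ℝ => e.symm (WithLp.toLp 2 p)) :=
    (measurePreserving_affineIsometryEquiv_symm e).comp (WithLp.volume_preserving_toLp _ _)
  rw [← hm.lintegral_comp hf, Measure.volume_eq_prod]
  exact (lintegral_prod _ (hf.comp hm.measurable).aemeasurable).symm

/-- The surface measure of the graph of a Lipschitz function is controlled by Lebesgue measure. -/
theorem setLIntegral_graph_le (hψ : LipschitzWith M ψ) {A : Set (RSpace d)}
    (hAr : A ⊆ range (graphMap e ψ)) {f : RSpace d → ℝ≥0∞}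
    (hf : Measurable f) :
    ∫⁻ x in A, f x ∂(μHE[d - 1] : Measure (RSpace d))
      ≤ (1 + M : ℝ≥0∞) ^ (d - 1) * ∫⁻ y in graphMap e ψ ⁻¹' A, f (graphMap e ψ y) := by
  have hlip := lipschitzWith_graphMap e hψ
  -- It suffices to compare measures: `graphMap` is Lipschitz, so it enlarges `(d - 1)`-dimensional
  -- measure by at most `(1 + M)^(d - 1)`.
  have hle : (μHE[d - 1] : Measure (RSpace d)).restrict A
      ≤ ((1 + M : ℝ≥0∞) ^ (d - 1)) •
        (volume.restrict (graphMap e ψ ⁻¹' A)).map (graphMap e ψ) := by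
    refine Measure.le_iff.2 fun s hs => ?_
    rw [Measure.restrict_apply hs, Measure.smul_apply,
      Measure.map_apply hlip.continuous.measurable hs,
      Measure.restrict_apply (hlip.continuous.measurable hs), ← preimage_inter, smul_eq_mul]
    have h1 : graphMap e ψ '' (graphMap e ψ ⁻¹' (s ∩ A)) = s ∩ A :=
      image_preimage_eq_of_subset (inter_subset_right.trans hAr)
    have h2 := hlip.euclideanHausdorffMeasure_image_le (d - 1) (graphMap e ψ ⁻¹' (s ∩ A))
    rw [h1, EuclideanSpace.euclideanHausdorffMeasure_eq_volume] at h2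
    exact_mod_cast h2
  refine (lintegral_mono' hle le_rfl).trans ?_
  rw [lintegral_smul_measure, lintegral_map hf hlip.continuous.measurable, smul_eq_mul]

end Graph

/-! ### Pointwise bounds along a segment -/

section Segment

variable {d : ℕ}

theorem norm_fderiv_apply_le_classicalGrad (φ : RSpace d → ℂ) (x v : RSpace d) :
    ‖fderiv ℝ φ x v‖ ≤ ‖v‖ * ‖classicalGrad φ x‖ := by
  have h1 : fderiv ℝ φ x v = ∑ i, v i • partialDeriv i φ x := by
    conv_lhs => rw [← (EuclideanSpace.basisFun (Fin d) ℝ).sum_repr v]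
    simp [partialDeriv]
  rw [h1, EuclideanSpace.norm_eq, EuclideanSpace.norm_eq]
  refine (norm_sum_le _ _).trans ?_
  simp_rw [norm_smul]
  exact Real.sum_mul_le_sqrt_mul_sqrt _ _ _

/-- By the fundamental theorem of calculus, `h 0 ≤ h s + ∫ |h'|` for every `s` in `[0, ε]`;
averaging over `s` gives the bound. -/
theorem ofReal_le_lintegral_of_hasDerivAt {h h' : ℝ → ℝ} {ε : ℝ} (hε : 0 < ε)
    (hh : ∀ t, HasDerivAt h (h' t) t) (hc : Continuous h') (h0 : ∀ t, 0 ≤ h t) :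
    ENNReal.ofReal (h 0) ≤ ∫⁻ t in Ioo 0 ε, ENNReal.ofReal (ε⁻¹ * h t + |h' t|) := by
  have hcont : Continuous h := continuous_iff_continuousAt.2 fun t => (hh t).continuousAt
  have hint : ∀ a b, IntervalIntegrable (fun t => |h' t|) volume a b := fun a b =>
    hc.abs.intervalIntegrable a b
  have h1 : ∀ s ∈ Icc 0 ε, h 0 ≤ h s + ∫ t in 0..ε, |h' t| := by
    intro s hs
    have e1 : ∫ t in 0..s, h' t = h s - h 0 :=
      intervalIntegral.integral_eq_sub_of_hasDerivAt (fun t _ => hh t) (hc.intervalIntegrable _ _)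
    have e2 : |∫ t in 0..s, h' t| ≤ ∫ t in 0..s, |h' t| :=
      intervalIntegral.abs_integral_le_integral_abs hs.1
    have e3 : ∫ t in 0..s, |h' t| ≤ ∫ t in 0..ε, |h' t| :=
      intervalIntegral.integral_mono_interval le_rfl hs.1 hs.2
        (Eventually.of_forall fun _ => abs_nonneg _) (hint _ _)
    have := neg_abs_le (∫ t in 0..s, h' t)
    linarith
  have h2 : ε * h 0 ≤ (∫ s in 0..ε, h s) + ε * ∫ t in 0..ε, |h' t| := by
    have := intervalIntegral.integral_mono_on hε.le
      (continuous_const (y := h 0) |>.intervalIntegrable (μ := volume) 0 ε)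
      ((hcont.add continuous_const).intervalIntegrable (μ := volume) 0 ε) h1
    refine (le_of_eq (by simp)).trans (this.trans (le_of_eq ?_))
    refine (intervalIntegral.integral_add (hcont.intervalIntegrable _ _)
      (continuous_const.intervalIntegrable _ _)).trans ?_
    simp
  have h3 : h 0 ≤ ∫ t in 0..ε, (ε⁻¹ * h t + |h' t|) := by
    have hci : IntervalIntegrable (fun t => ε⁻¹ * h t) volume 0 ε :=
      (continuous_const.mul hcont).intervalIntegrable _ _
    rw [intervalIntegral.integral_add hci (hint _ _), intervalIntegral.integral_const_mul, ← mul_le_mul_iff_right₀ hε, mul_add,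
      mul_inv_cancel_left₀ hε.ne']
    exact h2
  rw [intervalIntegral.integral_of_le hε.le, integral_Ioc_eq_integral_Ioo] at h3
  refine (ENNReal.ofReal_le_ofReal h3).trans (le_of_eq ?_)
  refine ofReal_integral_eq_lintegral_ofReal ?_ ?_
  · exact ((continuous_const.mul hcont).add hc.abs).integrableOn_Icc.mono_set Ioo_subset_Icc_self
  · exact Eventually.of_forall fun t => by have := h0 t; positivity

/-- The one-dimensional bound for `h t = |φ(x + t v)|²`, with `|h'| ≤ 2 |φ| |∇φ| ≤ δ⁻¹ |φ|² + δ
|∇φ|²`. The free `δ` is the source of the relative bound `0`. -/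
theorem enorm_sq_le_lintegral_segment {φ : RSpace d → ℂ} (hφ : ContDiff ℝ 1 φ)
    (x v : RSpace d) (hv : ‖v‖ = 1) {ε δ : ℝ} (hε : 0 < ε) (hδ : 0 < δ) :
    ‖φ x‖ₑ ^ 2 ≤ ∫⁻ t in Ioo 0 ε, (ENNReal.ofReal (ε⁻¹ + δ⁻¹) * ‖φ (x + t • v)‖ₑ ^ 2
      + ENNReal.ofReal δ * ‖classicalGrad φ (x + t • v)‖ₑ ^ 2) := by
  have hd : ∀ t : ℝ, HasDerivAt (fun t : ℝ => φ (x + t • v)) (fderiv ℝ φ (x + t • v) v) t := by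
    intro t
    have h1 : HasDerivAt (fun t : ℝ => x + t • v) v t := by
      simpa using ((hasDerivAt_id t).smul_const v).const_add x
    exact ((hφ.differentiable one_ne_zero) (x + t • v)).hasFDerivAt.comp_hasDerivAt t h1
  have hd2 := fun t => (hd t).norm_sq
  have hcont : Continuous fun t : ℝ => x + t • v := by fun_prop
  have hc1 : Continuous fun t : ℝ => φ (x + t • v) := hφ.continuous.comp hcont
  have hc2 : Continuous fun t : ℝ => fderiv ℝ φ (x + t • v) v :=
    ((hφ.continuous_fderiv one_ne_zero).comp hcont).clm_apply continuous_const
  have key := ofReal_le_lintegral_of_hasDerivAt hε hd2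
    (continuous_const.mul (hc1.inner hc2)) (fun t => sq_nonneg _)
  have e0 : ∀ (E : Type) [NormedAddCommGroup E] (z : E), ‖z‖ₑ ^ 2 = ENNReal.ofReal (‖z‖ ^ 2) := by
    intro E _ z
    rw [ENNReal.ofReal_pow (norm_nonneg _), ofReal_norm]
  simp only [zero_smul, add_zero] at key
  rw [e0]
  refine key.trans (lintegral_mono fun t => ?_)
  change ENNReal.ofReal _ ≤ _
  rw [e0, e0, ← ENNReal.ofReal_mul (by positivity), ← ENNReal.ofReal_mul (by positivity),
    ← ENNReal.ofReal_add (by positivity) (by positivity)]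
  refine ENNReal.ofReal_le_ofReal ?_
  set a := ‖φ (x + t • v)‖
  set b := ‖classicalGrad φ (x + t • v)‖
  have h1 : |2 * inner ℝ (φ (x + t • v)) (fderiv ℝ φ (x + t • v) v)| ≤ 2 * (a * b) := by
    rw [abs_mul, abs_two]
    gcongr
    refine (abs_real_inner_le_norm _ _).trans ?_
    gcongr
    have := norm_fderiv_apply_le_classicalGrad φ (x + t • v) v
    rwa [hv, one_mul] at this
  have h2 : 2 * (a * b) ≤ δ⁻¹ * a ^ 2 + δ * b ^ 2 := by
    have : 0 ≤ δ⁻¹ * (a - δ * b) ^ 2 := by positivity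
    have h3 : δ⁻¹ * (a - δ * b) ^ 2 = δ⁻¹ * a ^ 2 + δ * b ^ 2 - 2 * (a * b) := by
      field_simp
      ring
    linarith
  linarith

end Segment

/-! ### The trace inequality on a Lipschitz domain -/

section TraceInequality

variable {d : ℕ} {Ω U : Set (RSpace d)}
  {e : RSpace d ≃ᵃⁱ[ℝ] WithLp 2 (RSpace (d - 1) × ℝ)} {ψ : RSpace (d - 1) → ℝ} {M : ℝ≥0}

/-- A frontier point in `U` is a limit of points of `U ∩ Ω`, so it is not below the graph. It is not
strictly above either, because the open set `Ω` misses its frontier. -/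
theorem graphMap_fst_of_mem_frontier (hΩ : IsOpen Ω) (hU : IsOpen U) (hψ : Continuous ψ)
    (h : U ∩ Ω = U ∩ {x | ψ (e x).fst < (e x).snd}) {x : RSpace d} (hx : x ∈ frontier Ω)
    (hxU : x ∈ U) : graphMap e ψ (e x).fst = x := by
  have h1 : ψ (e x).fst ≤ (e x).snd := by
    have hc : IsClosed {x : RSpace d | ψ (e x).fst ≤ (e x).snd} :=
      isClosed_le (hψ.comp ((WithLp.prod_continuous_ofLp 2 _ _).comp e.continuous).fst)
        ((WithLp.prod_continuous_ofLp 2 _ _).comp e.continuous).snd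
    have h2 : x ∈ closure (U ∩ Ω) :=
      hU.inter_closure ⟨hxU, frontier_subset_closure hx⟩
    rw [h] at h2
    exact closure_minimal (fun z hz => le_of_lt (show ψ (e z).fst < (e z).snd from hz.2)) hc h2
  have h2 : (e x).snd ≤ ψ (e x).fst := by
    by_contra! hlt
    have h3 : x ∈ U ∩ Ω := by rw [h]; exact ⟨hxU, hlt⟩
    rw [hΩ.frontier_eq] at hx
    exact hx.2 h3.2
  unfold graphMap
  rw [le_antisymm h1 h2, AffineIsometryEquiv.symm_apply_eq]
  rfl

theorem graphMap_add_smul_mem_iff (h : U ∩ Ω = U ∩ {x | ψ (e x).fst < (e x).snd})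
    (y : RSpace (d - 1)) (t : ℝ) (hU : graphMap e ψ y + t • verticalVec e ∈ U) :
    graphMap e ψ y + t • verticalVec e ∈ Ω ↔ 0 < t := by
  have h1 : graphMap e ψ y + t • verticalVec e ∈ Ω ↔
      graphMap e ψ y + t • verticalVec e ∈ U ∩ Ω := by simp [hU]
  rw [h1, h, mem_inter_iff, mem_ofPred_eq]
  simp only [hU, true_and]
  rw [graphMap_add_smul_eq, AffineIsometryEquiv.apply_symm_apply]
  simp

theorem graphMap_mem_frontier (h : U ∩ Ω = U ∩ {x | ψ (e x).fst < (e x).snd}) (hU : IsOpen U)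
    (hΩ : IsOpen Ω) {y : RSpace (d - 1)} (hy : graphMap e ψ y ∈ U) :
    graphMap e ψ y ∈ frontier Ω := by
  have hc : Continuous fun t : ℝ => graphMap e ψ y + t • verticalVec e := by fun_prop
  have ht : Tendsto (fun t : ℝ => graphMap e ψ y + t • verticalVec e) (𝓝[>] 0)
      (𝓝 (graphMap e ψ y)) := by
    have := hc.tendsto 0
    simp only [zero_smul, add_zero] at this
    exact this.mono_left nhdsWithin_le_nhds
  rw [hΩ.frontier_eq]
  constructor
  · refine mem_closure_of_tendsto ht ?_
    filter_upwards [ht (hU.mem_nhds hy), self_mem_nhdsWithin] with t h1 h2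
    exact (graphMap_add_smul_mem_iff h y t h1).2 h2
  · have := graphMap_add_smul_mem_iff h y 0 (by simpa using hy)
    simp only [zero_smul, add_zero, lt_self_iff_false, iff_false] at this
    exact this

theorem continuous_classicalGrad {φ : RSpace d → ℂ} (hφ : ContDiff ℝ 1 φ) :
    Continuous (classicalGrad φ) := by
  refine (PiLp.continuous_toLp 2 _).comp (continuous_pi fun i => ?_)
  exact (hφ.continuous_fderiv one_ne_zero).clm_apply continuous_const

/-- If `B_ε(x) ⊆ U`, the vertical segment of length `ε` above the boundary point `x` stays in `U ∩
Ω`. Integrating the segment bound over such `x` and using slices bounds the left side by a volume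
integral. -/
theorem local_trace_inequality (hΩ : IsOpen Ω) (hU : IsOpen U) (hψ : LipschitzWith M ψ)
    (h : U ∩ Ω = U ∩ {x | ψ (e x).fst < (e x).snd}) {ε δ : ℝ} (hε : 0 < ε) (hδ : 0 < δ)
    {φ : RSpace d → ℂ} (hφ : ContDiff ℝ 1 φ) :
    ∫⁻ x in {x | x ∈ frontier Ω ∧ Metric.ball x ε ⊆ U}, ‖φ x‖ₑ ^ 2 ∂(μHE[d - 1] : Measure (RSpace d))
      ≤ (1 + M : ℝ≥0∞) ^ (d - 1) * ∫⁻ x in U ∩ Ω,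
        (ENNReal.ofReal (ε⁻¹ + δ⁻¹) * ‖φ x‖ₑ ^ 2
          + ENNReal.ofReal δ * ‖classicalGrad φ x‖ₑ ^ 2) := by
  set A : Set (RSpace d) := {x | x ∈ frontier Ω ∧ Metric.ball x ε ⊆ U} with hA
  set G : RSpace d → ℝ≥0∞ := fun x => ENNReal.ofReal (ε⁻¹ + δ⁻¹) * ‖φ x‖ₑ ^ 2
          + ENNReal.ofReal δ * ‖classicalGrad φ x‖ₑ ^ 2 with hG
  have hGm : Measurable G := by
    have := hφ.continuous.measurable
    have := (continuous_classicalGrad hφ).measurable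
    fun_prop
  have hAr : A ⊆ range (graphMap e ψ) := fun x hx =>
    ⟨_, graphMap_fst_of_mem_frontier hΩ hU hψ.continuous h hx.1
      (hx.2 (Metric.mem_ball_self hε))⟩
  refine (setLIntegral_graph_le e hψ hAr (hφ.continuous.measurable.enorm.pow_const 2)).trans ?_
  gcongr
  have hUΩ : MeasurableSet (U ∩ Ω) := (hU.inter hΩ).measurableSet
  rw [← lintegral_indicator hUΩ, ← lintegral_graph_slices e (ψ := ψ) (hGm.indicator hUΩ)]
  refine (setLIntegral_mono' ?_ ?_).trans (setLIntegral_le_lintegral (graphMap e ψ ⁻¹' A) _)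
  · refine (lipschitzWith_graphMap e hψ).continuous.measurable ?_
    -- This description shows that `A` is closed, hence measurable.
    have h2 : A = frontier Ω ∩ ⋂ z ∈ Uᶜ, {x | ε ≤ dist z x} := by
      ext x
      simp only [hA, mem_ofPred_eq, mem_inter_iff, mem_iInter, mem_compl_iff, and_congr_right_iff]
      intro _
      constructor
      · intro hb z hz
        by_contra! hlt
        exact hz (hb hlt)
      · intro hb z hz
        by_contra hzU
        exact absurd (hb z hzU) (not_le.2 hz)
    rw [h2]
    exact (isClosed_frontier.inter (isClosed_biInter fun z _ =>
      isClosed_le continuous_const (continuous_const.dist continuous_id))).measurableSet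
  · intro y hy
    refine (enorm_sq_le_lintegral_segment hφ (graphMap e ψ y) (verticalVec e)
      (norm_verticalVec e) hε hδ).trans ?_
    rw [← lintegral_indicator measurableSet_Ioo]
    refine lintegral_mono fun t => ?_
    by_cases ht : t ∈ Ioo 0 ε
    · rw [indicator_of_mem ht]
      have hmU : graphMap e ψ y + t • verticalVec e ∈ U := by
        refine hy.2 ?_
        rw [mem_ball_iff_norm, add_sub_cancel_left, norm_smul, norm_verticalVec, mul_one,
          Real.norm_eq_abs, abs_of_pos ht.1]
        exact ht.2
      have hmem : graphMap e ψ y + t • verticalVec e ∈ U ∩ Ω :=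
        ⟨hmU, (graphMap_add_smul_mem_iff h y t hmU).2 ht.1⟩
      rw [indicator_of_mem hmem]
    · rw [indicator_of_notMem ht]
      exact zero_le

/-- After exchanging sum and integral, the integrand at `x` is `G x` times the number of `V j`
containing `x`. -/
theorem tsum_setLIntegral_le {V : ℕ → Set (RSpace d)} {N : ℕ} (hV : ∀ j, IsOpen (V j))
    (hN : ∀ x, {j | x ∈ V j}.encard ≤ N) {G : RSpace d → ℝ≥0∞}
    (hG : Measurable G) :
    ∑' j, ∫⁻ x in V j ∩ Ω, G x ≤ N * ∫⁻ x in Ω, G x := by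
  have h1 : ∀ j, ∫⁻ x in V j ∩ Ω, G x = ∫⁻ x in Ω, (V j).indicator G x := fun j => by
    rw [lintegral_indicator (hV j).measurableSet, Measure.restrict_restrict (hV j).measurableSet]
  simp_rw [h1]
  rw [← lintegral_tsum fun j => (hG.indicator (hV j).measurableSet).aemeasurable,
    ← lintegral_const_mul _ hG]
  refine lintegral_mono fun x => ?_
  have h2 : ∀ j, (V j).indicator G x = {j | x ∈ V j}.indicator (fun _ => (1 : ℝ≥0∞)) j * G x := by
    intro j
    by_cases hx : x ∈ V j <;> simp [indicator, hx]
  simp_rw [h2]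
  rw [ENNReal.tsum_mul_right, ← tsum_subtype, ENNReal.tsum_set_one]
  gcongr
  exact_mod_cast hN x

/-- The trace inequality: the trace is bounded relative to the gradient with relative bound `0`. -/
theorem IsLipschitzDomain.trace_inequality (hΩ : IsLipschitzDomain Ω) {δ : ℝ} (hδ : 0 < δ) :
    ∃ C : ℝ, 0 ≤ C ∧ ∀ φ : RSpace d → ℂ, ContDiff ℝ 1 φ →
      ∫⁻ x, ‖φ x‖ₑ ^ 2 ∂(surfaceMeasure (frontier Ω))
        ≤ ENNReal.ofReal δ * (∫⁻ x in Ω, ‖classicalGrad φ x‖ₑ ^ 2)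
          + ENNReal.ofReal C * ∫⁻ x in Ω, ‖φ x‖ₑ ^ 2 := by
  obtain ⟨hO, -, ε, N, M, V, hε, hV, hball, hN, hD⟩ := hΩ
  -- `L` combines the distortion of the charts with their overlap. Running the local inequality at
  -- `η = δ / (L + 1)` gives `L η ≤ δ`, and the `+ 1` covers `L = 0`.
  set L : ℝ := (1 + M) ^ (d - 1) * N with hL
  have hL0 : 0 ≤ L := by positivity
  set η : ℝ := δ / (L + 1) with hη
  have hη0 : 0 < η := by positivity
  refine ⟨L * (ε⁻¹ + η⁻¹), by positivity, fun φ hφ => ?_⟩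
  set G : RSpace d → ℝ≥0∞ := fun x => ENNReal.ofReal (ε⁻¹ + η⁻¹) * ‖φ x‖ₑ ^ 2
          + ENNReal.ofReal η * ‖classicalGrad φ x‖ₑ ^ 2 with hG
  have hφm := hφ.continuous.measurable
  have hgm := (continuous_classicalGrad hφ).measurable
  have hGm : Measurable G := by fun_prop
  have hLe : ENNReal.ofReal L = (1 + M : ℝ≥0∞) ^ (d - 1) * N := by
    have : L = (((1 + M) ^ (d - 1) * N : ℝ≥0) : ℝ) := by rw [hL]; push_cast; rfl
    rw [this, ENNReal.ofReal_coe_nnreal]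
    push_cast
    rfl
  calc ∫⁻ x, ‖φ x‖ₑ ^ 2 ∂(surfaceMeasure (frontier Ω))
      ≤ ∫⁻ x in ⋃ j, {x | x ∈ frontier Ω ∧ Metric.ball x ε ⊆ V j}, ‖φ x‖ₑ ^ 2
          ∂(μHE[d - 1] : Measure (RSpace d)) := by
        refine lintegral_mono_set fun x hx => ?_
        obtain ⟨j, hj⟩ := hball x hx
        exact mem_iUnion.2 ⟨j, hx, hj⟩
    _ ≤ ∑' j, ∫⁻ x in {x | x ∈ frontier Ω ∧ Metric.ball x ε ⊆ V j}, ‖φ x‖ₑ ^ 2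
          ∂(μHE[d - 1] : Measure (RSpace d)) := lintegral_iUnion_le _ _
    _ ≤ ∑' j, (1 + M : ℝ≥0∞) ^ (d - 1) * ∫⁻ x in V j ∩ Ω, G x := by
        refine ENNReal.tsum_le_tsum fun j => ?_
        obtain ⟨D, ⟨e, ψ, hψ, rfl⟩, hj⟩ := hD j
        exact local_trace_inequality hO (hV j) hψ hj hε hη0 hφ
    _ ≤ (1 + M : ℝ≥0∞) ^ (d - 1) * (N * ∫⁻ x in Ω, G x) := by
        rw [ENNReal.tsum_mul_left]
        gcongr
        exact tsum_setLIntegral_le hV hN hGm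
    _ = ENNReal.ofReal (L * η) * (∫⁻ x in Ω, ‖classicalGrad φ x‖ₑ ^ 2)
          + ENNReal.ofReal (L * (ε⁻¹ + η⁻¹)) * ∫⁻ x in Ω, ‖φ x‖ₑ ^ 2 := by
        rw [← mul_assoc, ← hLe, ENNReal.ofReal_mul hL0, ENNReal.ofReal_mul hL0,
          lintegral_add_left (by fun_prop), lintegral_const_mul _ (by fun_prop),
          lintegral_const_mul _ (by fun_prop)]
        ring
    _ ≤ _ := by
        gcongr
        rw [hη, mul_div_assoc', div_le_iff₀ (by positivity)]
        nlinarith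

/-- The boundary of a Lipschitz domain has positive surface measure. -/
theorem IsLipschitzDomain.surfaceMeasure_frontier_ne_zero (hΩ : IsLipschitzDomain Ω)
    (hne : Ω ≠ univ) : surfaceMeasure (frontier Ω) univ ≠ 0 := by
  obtain ⟨hO, hconn, ε, N, M, V, hε, hV, hball, hN, hD⟩ := hΩ
  obtain ⟨x, hx⟩ : (frontier Ω).Nonempty := by
    rw [nonempty_iff_ne_empty]
    intro h0
    rcases isClopen_iff.1 (isClopen_iff_frontier_eq_empty.2 h0) with h | h
    · exact hconn.nonempty.ne_empty h
    · exact hne h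
  obtain ⟨j, hj⟩ := hball x hx
  obtain ⟨D, ⟨e, ψ, hψ, rfl⟩, hjD⟩ := hD j
  have hxV := hj (Metric.mem_ball_self hε)
  have hxg := graphMap_fst_of_mem_frontier hO (hV j) hψ.continuous hjD hx hxV
  set W := graphMap e ψ ⁻¹' (V j) with hW
  have hWo : IsOpen W := (hV j).preimage (lipschitzWith_graphMap e hψ).continuous
  have hWne : W.Nonempty := ⟨(e x).fst, by rw [hW, mem_preimage, hxg]; exact hxV⟩
  -- The projection onto the chart's base is `1`-Lipschitz and its image of the frontier contains
  -- the non-empty open set `W`, so the frontier cannot be a null set.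
  have hsub : W ⊆ (fun x : RSpace d => (e x).fst) '' frontier Ω := by
    intro y hy
    refine ⟨graphMap e ψ y, graphMap_mem_frontier hjD (hV j) hO hy, ?_⟩
    simp [graphMap]
  have hlip : LipschitzWith 1 (fun x : RSpace d => (e x).fst) := by
    refine LipschitzWith.of_dist_le_mul fun a b => ?_
    rw [NNReal.coe_one, one_mul, ← e.dist_map a b, WithLp.prod_dist_eq_of_L2]
    exact Real.le_sqrt_of_sq_le (by nlinarith [sq_nonneg (dist (e a).snd (e b).snd)])
  have h1 := hlip.euclideanHausdorffMeasure_image_le (d - 1) (frontier Ω)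
  rw [EuclideanSpace.euclideanHausdorffMeasure_eq_volume] at h1
  have h2 : 0 < volume W := hWo.measure_pos _ hWne
  have h3 := h2.trans_le ((measure_mono hsub).trans h1)
  simp only [surfaceMeasure, Measure.restrict_apply MeasurableSet.univ, univ_inter]
  intro h0
  rw [h0] at h3
  simp at h3

end TraceInequality

/-! ### Test functions, closedness of `H¹`, and the trace graph -/

section TestFunctions

variable {d : ℕ} {U S : Set (RSpace d)}

theorem classicalGrad_add {φ χ : RSpace d → ℂ} (hφ : ContDiff ℝ ∞ φ) (hχ : ContDiff ℝ ∞ χ) :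
    classicalGrad (φ + χ) = classicalGrad φ + classicalGrad χ := by
  ext x i
  have h1 := hφ.differentiable (by simp) x
  have h2 := hχ.differentiable (by simp) x
  simp [classicalGrad, partialDeriv, fderiv_add h1 h2]

theorem classicalGrad_const_smul {φ : RSpace d → ℂ} (hφ : ContDiff ℝ ∞ φ) (c : ℂ) :
    classicalGrad (c • φ) = c • classicalGrad φ := by
  ext x i
  have h1 := hφ.differentiable (by simp) x
  simp [classicalGrad, partialDeriv, fderiv_const_smul h1 c]

theorem hasCompactSupport_classicalGrad {φ : RSpace d → ℂ} (hφ : HasCompactSupport φ) :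
    HasCompactSupport (classicalGrad φ) := by
  refine (hφ.fderiv ℝ).mono fun x hx h => hx ?_
  ext i
  simp [classicalGrad, partialDeriv, h]

/-- Pairs `(φ, ∇φ)` on `U` with `φ ∈ C_c^∞(ℝ^d)`. -/
noncomputable def testPairs (U : Set (RSpace d)) : Submodule ℂ (WithLp 2 (L2 U × L2Vec U)) where
  carrier := {p | ∃ φ : RSpace d → ℂ, ContDiff ℝ ∞ φ ∧ HasCompactSupport φ ∧
    p.fst =ᵐ[volume.restrict U] φ ∧ p.snd =ᵐ[volume.restrict U] classicalGrad φ}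
  zero_mem' := by
    refine ⟨0, contDiff_const, HasCompactSupport.zero, Lp.coeFn_zero _ _ _, ?_⟩
    have : classicalGrad (0 : RSpace d → ℂ) = 0 := by
      ext x i; simp [classicalGrad, partialDeriv]
    rw [this]
    exact Lp.coeFn_zero _ _ _
  add_mem' := by
    rintro p q ⟨φ, h1, h2, h3, h4⟩ ⟨χ, k1, k2, k3, k4⟩
    refine ⟨φ + χ, h1.add k1, h2.add k2, (Lp.coeFn_add _ _).trans (h3.add k3), ?_⟩
    rw [classicalGrad_add h1 k1]
    exact (Lp.coeFn_add _ _).trans (h4.add k4)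
  smul_mem' := by
    rintro c p ⟨φ, h1, h2, h3, h4⟩
    refine ⟨c • φ, h1.const_smul c, h2.smul_left (f := fun _ => c),
      (Lp.coeFn_smul _ _).trans (h3.const_smul c), ?_⟩
    rw [classicalGrad_const_smul h1 c]
    exact (Lp.coeFn_smul _ _).trans (h4.const_smul c)

/-- Triples `(φ, ∇φ, φ|_S)` with `φ ∈ C_c^∞(ℝ^d)`. -/
noncomputable def testTriples (U S : Set (RSpace d)) :
    Submodule ℂ (WithLp 2 (WithLp 2 (L2 U × L2Vec U) × L2Surf S)) where
  carrier := {p | ∃ φ : RSpace d → ℂ, ContDiff ℝ ∞ φ ∧ HasCompactSupport φ ∧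
    p.fst.fst =ᵐ[volume.restrict U] φ ∧ p.fst.snd =ᵐ[volume.restrict U] classicalGrad φ ∧
    p.snd =ᵐ[surfaceMeasure S] φ}
  zero_mem' := by
    refine ⟨0, contDiff_const, HasCompactSupport.zero, Lp.coeFn_zero _ _ _, ?_,
      Lp.coeFn_zero _ _ _⟩
    have : classicalGrad (0 : RSpace d → ℂ) = 0 := by
      ext x i; simp [classicalGrad, partialDeriv]
    rw [this]
    exact Lp.coeFn_zero _ _ _
  add_mem' := by
    rintro p q ⟨φ, h1, h2, h3, h4, h5⟩ ⟨χ, k1, k2, k3, k4, k5⟩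
    refine ⟨φ + χ, h1.add k1, h2.add k2, (Lp.coeFn_add _ _).trans (h3.add k3), ?_,
      (Lp.coeFn_add _ _).trans (h5.add k5)⟩
    rw [classicalGrad_add h1 k1]
    exact (Lp.coeFn_add _ _).trans (h4.add k4)
  smul_mem' := by
    rintro c p ⟨φ, h1, h2, h3, h4, h5⟩
    refine ⟨c • φ, h1.const_smul c, h2.smul_left (f := fun _ => c),
      (Lp.coeFn_smul _ _).trans (h3.const_smul c), ?_,
      (Lp.coeFn_smul _ _).trans (h5.const_smul c)⟩
    rw [classicalGrad_const_smul h1 c]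
    exact (Lp.coeFn_smul _ _).trans (h4.const_smul c)

theorem memLp_of_contDiff {φ : RSpace d → ℂ} (h1 : ContDiff ℝ ∞ φ) (h2 : HasCompactSupport φ) :
    MemLp φ 2 (volume.restrict U) :=
  h1.continuous.memLp_of_hasCompactSupport h2

theorem memLp_classicalGrad {φ : RSpace d → ℂ} (h1 : ContDiff ℝ ∞ φ) (h2 : HasCompactSupport φ) :
    MemLp (classicalGrad φ) 2 (volume.restrict U) :=
  (continuous_classicalGrad (h1.of_le (by simp))).memLp_of_hasCompactSupport
    (hasCompactSupport_classicalGrad h2)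

/-- Classical gradients are weak gradients. -/
theorem isWeakGrad_classicalGrad {φ : RSpace d → ℂ} (h1 : ContDiff ℝ ∞ φ) :
    IsWeakGrad U φ (classicalGrad φ) := by
  intro χ k1 k2 k3 i
  have e1 : ∫ x in U, partialDeriv i χ x • φ x = ∫ x, partialDeriv i χ x • φ x := by
    refine setIntegral_eq_integral_of_forall_compl_eq_zero fun x hx => ?_
    have : fderiv ℝ χ x = 0 := by
      by_contra h
      exact hx (k3 (tsupport_fderiv_subset ℝ (subset_closure h)))
    simp [partialDeriv, this]
  have e2 : ∫ x in U, χ x • classicalGrad φ x i = ∫ x, χ x • classicalGrad φ x i := by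
    refine setIntegral_eq_integral_of_forall_compl_eq_zero fun x hx => ?_
    have : χ x = 0 := by
      by_contra h
      exact hx (k3 (subset_closure h))
    simp [this]
  rw [e1, e2]
  have c1 : Continuous fun x => fderiv ℝ φ x (EuclideanSpace.single i 1) :=
    (h1.continuous_fderiv (by simp)).clm_apply continuous_const
  have c2 : Continuous (partialDeriv i χ) := continuous_partialDeriv k1 i
  have := integral_smul_fderiv_eq_neg_fderiv_smul_of_integrable (μ := volume) (𝕜 := ℝ)
    (f := χ) (g := φ) (v := EuclideanSpace.single i 1)
    ((c2.smul h1.continuous).integrable_of_hasCompactSupport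
      (hasCompactSupport_partialDeriv k2 i).smul_right)
    ((k1.continuous.smul c1).integrable_of_hasCompactSupport k2.smul_right)
    ((k1.continuous.smul h1.continuous).integrable_of_hasCompactSupport k2.smul_right)
    (fun x _ => k1.differentiable (by simp) x) (fun x _ => h1.differentiable (by simp) x)
  change ∫ x, partialDeriv i χ x • φ x = -∫ x, χ x • fderiv ℝ φ x (EuclideanSpace.single i 1)
  rw [this, neg_neg]
  rfl

theorem isWeakGrad_congr {f f' : RSpace d → ℂ} {G G' : RSpace d → EuclideanSpace ℂ (Fin d)}
    (hf : f =ᵐ[volume.restrict U] f') (hG : G =ᵐ[volume.restrict U] G') (h : IsWeakGrad U f G) :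
    IsWeakGrad U f' G' := by
  intro χ k1 k2 k3 i
  have e1 : ∫ x in U, partialDeriv i χ x • f' x = ∫ x in U, partialDeriv i χ x • f x :=
    integral_congr_ae (by filter_upwards [hf] with x hx; rw [hx])
  have e2 : ∫ x in U, χ x • G' x i = ∫ x in U, χ x • G x i :=
    integral_congr_ae (by filter_upwards [hG] with x hx; rw [hx])
  rw [e1, e2]
  exact h χ k1 k2 k3 i

theorem testPairs_le_H1 : testPairs U ≤ H1 U := by
  rintro p ⟨φ, h1, h2, h3, h4⟩
  exact isWeakGrad_congr h3.symm h4.symm (isWeakGrad_classicalGrad h1)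

theorem continuous_setIntegral_smul {g : RSpace d → ℝ} (hg : Continuous g)
    (hgc : HasCompactSupport g) : Continuous fun f : L2 U => ∫ x in U, g x • f x := by
  have hm : MemLp (fun x => (g x : ℂ)) 2 (volume.restrict U) :=
    (Complex.continuous_ofReal.comp hg).memLp_of_hasCompactSupport (hgc.comp_left (by simp))
  have h1 : (fun f : L2 U => ∫ x in U, g x • f x) = fun f : L2 U => inner ℂ (hm.toLp _) f := by
    funext f
    rw [L2.inner_def]
    refine integral_congr_ae ?_
    filter_upwards [hm.coeFn_toLp] with x hx
    rw [hx, RCLike.inner_apply, Complex.conj_ofReal, mul_comm, Complex.real_smul]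
  rw [h1]
  fun_prop

theorem isClosed_H1 : IsClosed (H1 U : Set (WithLp 2 (L2 U × L2Vec U))) := by
  have h1 : (H1 U : Set (WithLp 2 (L2 U × L2Vec U))) = ⋂ (φ : RSpace d → ℝ)
      (_ : ContDiff ℝ ∞ φ) (_ : HasCompactSupport φ) (_ : tsupport φ ⊆ U) (i : Fin d),
      {p | ∫ x in U, partialDeriv i φ x • p.fst x = - ∫ x in U, φ x • p.snd x i} := by
    ext p
    simp only [mem_iInter]
    rfl
  rw [h1]
  refine isClosed_iInter fun φ => isClosed_iInter fun k1 => isClosed_iInter fun k2 =>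
    isClosed_iInter fun _ => isClosed_iInter fun i => isClosed_eq ?_ ?_
  · exact (continuous_setIntegral_smul (continuous_partialDeriv k1 i)
      (hasCompactSupport_partialDeriv k2 i)).comp (WithLp.prod_continuous_ofLp 2 _ _).fst
  · refine Continuous.neg ?_
    have h2 : (fun p : WithLp 2 (L2 U × L2Vec U) => ∫ x in U, φ x • p.snd x i)
        = fun p => ∫ x in U, φ x •
          ((EuclideanSpace.proj (𝕜 := ℂ) i).compLpL 2 (volume.restrict U) p.snd) x := by
      funext p
      refine integral_congr_ae ?_
      filter_upwards [(EuclideanSpace.proj (𝕜 := ℂ) i).coeFn_compLp p.snd] with x hx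
      change _ = φ x • ((EuclideanSpace.proj (𝕜 := ℂ) i).compLp p.snd) x
      rw [hx]
      rfl
    rw [h2]
    exact (continuous_setIntegral_smul k1.continuous k2).comp
      (((EuclideanSpace.proj (𝕜 := ℂ) i).compLpL 2 (volume.restrict U)).continuous.comp
        (WithLp.prod_continuous_ofLp 2 _ _).snd)

/-- The graph of the trace operator. -/
noncomputable def traceGraph (U S : Set (RSpace d)) :
    Submodule ℂ (WithLp 2 (WithLp 2 (L2 U × L2Vec U) × L2Surf S)) :=
  (testTriples U S).topologicalClosure

instance : CompleteSpace (traceGraph U S) :=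
  (testTriples U S).isClosed_topologicalClosure.completeSpace_coe

theorem fst_mem_H1_of_mem_traceGraph
    {p : WithLp 2 (WithLp 2 (L2 U × L2Vec U) × L2Surf S)} (hp : p ∈ traceGraph U S) :
    p.fst ∈ H1 U := by
  have hc : IsClosed {p : WithLp 2 (WithLp 2 (L2 U × L2Vec U) × L2Surf S) | p.fst ∈ H1 U} :=
    isClosed_H1.preimage (WithLp.prod_continuous_ofLp 2 _ _).fst
  refine closure_minimal ?_ hc hp
  rintro q ⟨φ, h1, h2, h3, h4, -⟩
  exact testPairs_le_H1 ⟨φ, h1, h2, h3, h4⟩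

theorem ofReal_dist_eq_eLpNorm {E : Type*} [NormedAddCommGroup E] {μ : Measure (RSpace d)}
    (a c : Lp E 2 μ) {b : RSpace d → E} (hb : c =ᵐ[μ] b) :
    ENNReal.ofReal (dist a c) = eLpNorm (fun x => a x - b x) 2 μ := by
  rw [← Lp.edist_dist, Lp.edist_def]
  refine eLpNorm_congr_ae ?_
  filter_upwards [hb] with x hx
  simp [hx]

theorem dist_sq_triple (p q : WithLp 2 (WithLp 2 (L2 U × L2Vec U) × L2Surf S)) :
    dist p q ^ 2 = dist p.fst.fst q.fst.fst ^ 2 + dist p.fst.snd q.fst.snd ^ 2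
      + dist p.snd q.snd ^ 2 := by
  rw [WithLp.prod_dist_eq_of_L2, Real.sq_sqrt (by positivity), WithLp.prod_dist_eq_of_L2,
    Real.sq_sqrt (by positivity)]

/-- Approximating each component separately is equivalent to approximating in the product norm.
Traces thereby become points of a closed subspace, hence of a Hilbert space. -/
theorem isTrace_iff {f : H1 U} {u : L2Surf S} :
    IsTrace U S f u ↔ WithLp.toLp 2 (f.1, u) ∈ traceGraph U S := by
  have hmem : WithLp.toLp 2 (f.1, u) ∈ traceGraph U S ↔
      ∀ ε : ℝ, 0 < ε → ∃ q ∈ testTriples U S, dist (WithLp.toLp 2 (f.1, u)) q < ε :=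
    Metric.mem_closure_iff
  rw [hmem]
  constructor
  · intro h ε hε
    obtain ⟨φ, h1, h2, h3, h4, h5⟩ := h (ENNReal.ofReal (ε / 4)) (by positivity)
    -- The surface measure on `S` need not be locally finite here, so square integrability of `φ`
    -- comes from `u` and the small difference `u - φ`.
    have hm : MemLp φ 2 (surfaceMeasure S) := by
      have : φ = fun x => u x - (u x - φ x) := by funext x; simp
      rw [this]
      refine (Lp.memLp u).sub ⟨(Lp.aestronglyMeasurable u).sub
        h1.continuous.aestronglyMeasurable, h5.trans_lt ENNReal.ofReal_lt_top⟩
    have m1 := memLp_of_contDiff (U := U) h1 h2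
    have m2 := memLp_classicalGrad (U := U) h1 h2
    set q : WithLp 2 (WithLp 2 (L2 U × L2Vec U) × L2Surf S) :=
      WithLp.toLp 2 (WithLp.toLp 2 (m1.toLp φ, m2.toLp (classicalGrad φ)), hm.toLp φ) with hq
    refine ⟨q, ⟨φ, h1, h2, m1.coeFn_toLp, m2.coeFn_toLp, hm.coeFn_toLp⟩, ?_⟩
    have hε4 : 0 ≤ ε / 4 := by positivity
    rw [← ofReal_dist_eq_eLpNorm (fn f) (m1.toLp φ) m1.coeFn_toLp,
      ENNReal.ofReal_le_ofReal_iff hε4] at h3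
    rw [← ofReal_dist_eq_eLpNorm (grad f) (m2.toLp _) m2.coeFn_toLp,
      ENNReal.ofReal_le_ofReal_iff hε4] at h4
    rw [← ofReal_dist_eq_eLpNorm u (hm.toLp φ) hm.coeFn_toLp,
      ENNReal.ofReal_le_ofReal_iff hε4] at h5
    refine lt_of_pow_lt_pow_left₀ 2 hε.le ?_
    rw [dist_sq_triple]
    have s1 := pow_le_pow_left₀ dist_nonneg h3 2
    have s2 := pow_le_pow_left₀ dist_nonneg h4 2
    have s3 := pow_le_pow_left₀ dist_nonneg h5 2
    change dist (fn f) (m1.toLp φ) ^ 2 + dist (grad f) (m2.toLp (classicalGrad φ)) ^ 2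
      + dist u (hm.toLp φ) ^ 2 < _
    nlinarith
  · intro h ε hε
    obtain ⟨r, hr0, hr⟩ : ∃ r : ℝ, 0 < r ∧ ENNReal.ofReal r ≤ ε := by
      rcases eq_or_ne ε ⊤ with h | h
      · exact ⟨1, one_pos, by simp [h]⟩
      · exact ⟨ε.toReal, ENNReal.toReal_pos hε.ne' h, by rw [ENNReal.ofReal_toReal h]⟩
    obtain ⟨q, ⟨φ, h1, h2, h3, h4, h5⟩, hq⟩ := h r hr0
    have hs := dist_sq_triple (WithLp.toLp 2 (f.1, u)) q
    change _ = dist (fn f) q.fst.fst ^ 2 + dist (grad f) q.fst.snd ^ 2 + dist u q.snd ^ 2 at hs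
    refine ⟨φ, h1, h2, ?_, ?_, ?_⟩
    · rw [← ofReal_dist_eq_eLpNorm _ _ h3]
      refine le_trans (ENNReal.ofReal_le_ofReal (le_trans ?_ hq.le)) hr
      refine (pow_le_pow_iff_left₀ dist_nonneg dist_nonneg two_ne_zero).1 ?_
      rw [hs]; nlinarith [sq_nonneg (dist (grad f) q.fst.snd), sq_nonneg (dist u q.snd)]
    · rw [← ofReal_dist_eq_eLpNorm _ _ h4]
      refine le_trans (ENNReal.ofReal_le_ofReal (le_trans ?_ hq.le)) hr
      refine (pow_le_pow_iff_left₀ dist_nonneg dist_nonneg two_ne_zero).1 ?_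
      rw [hs]; nlinarith [sq_nonneg (dist (fn f) q.fst.fst), sq_nonneg (dist u q.snd)]
    · rw [← ofReal_dist_eq_eLpNorm _ _ h5]
      refine le_trans (ENNReal.ofReal_le_ofReal (le_trans ?_ hq.le)) hr
      refine (pow_le_pow_iff_left₀ dist_nonneg dist_nonneg two_ne_zero).1 ?_
      rw [hs]; nlinarith [sq_nonneg (dist (fn f) q.fst.fst), sq_nonneg (dist (grad f) q.fst.snd)]

end TestFunctions

/-! ### Density of test functions in `H¹(ℝ^d)` -/

section Density

open scoped SchwartzMap

variable {d : ℕ}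

theorem partialDeriv_re {φ : RSpace d → ℂ} (hφ : ContDiff ℝ ∞ φ) (i : Fin d) (x : RSpace d) :
    partialDeriv i (fun x => (φ x).re) x = (partialDeriv i φ x).re := by
  have h := Complex.reCLM.hasFDerivAt.comp x (hφ.differentiable (by simp) x).hasFDerivAt
  unfold partialDeriv
  rw [show (fun x => (φ x).re) = Complex.reCLM ∘ φ from rfl, h.fderiv]
  rfl

theorem partialDeriv_im {φ : RSpace d → ℂ} (hφ : ContDiff ℝ ∞ φ) (i : Fin d) (x : RSpace d) :
    partialDeriv i (fun x => (φ x).im) x = (partialDeriv i φ x).im := by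
  have h := Complex.imCLM.hasFDerivAt.comp x (hφ.differentiable (by simp) x).hasFDerivAt
  unfold partialDeriv
  rw [show (fun x => (φ x).im) = Complex.imCLM ∘ φ from rfl, h.fderiv]
  rfl

theorem integral_mul_eq_re_add_im {w c : RSpace d → ℂ} (hw : Continuous w)
    (hwc : HasCompactSupport w) (hc : MemLp c 2 volume) :
    ∫ x, w x * c x = (∫ x, (w x).re • c x) + Complex.I * ∫ x, (w x).im • c x := by
  rw [← integral_const_mul, ← integral_add]
  · refine integral_congr_ae (Eventually.of_forall fun x => ?_)
    simp only [Complex.real_smul]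
    conv_lhs => rw [← Complex.re_add_im (w x)]
    ring
  · exact integrable_smul_of_memLp (Complex.continuous_re.comp hw)
      (hwc.comp_left (g := Complex.re) rfl) hc
  · exact (integrable_smul_of_memLp (Complex.continuous_im.comp hw)
      (hwc.comp_left (g := Complex.im) rfl) hc).const_mul _

/-- From real to complex test functions. -/
theorem complex_pairing_eq_zero {a : RSpace d → ℂ} {b : Fin d → RSpace d → ℂ}
    (ha : MemLp a 2 volume) (hb : ∀ i, MemLp (b i) 2 volume)
    (h : ∀ φ : RSpace d → ℝ, ContDiff ℝ ∞ φ → HasCompactSupport φ →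
      (∫ x, φ x • a x) + ∑ i, ∫ x, partialDeriv i φ x • b i x = 0)
    {φ : RSpace d → ℂ} (hφ : ContDiff ℝ ∞ φ) (hφc : HasCompactSupport φ) :
    (∫ x, φ x * a x) + ∑ i, ∫ x, partialDeriv i φ x * b i x = 0 := by
  have hre := h (fun x => (φ x).re) (Complex.reCLM.contDiff.comp hφ)
    (hφc.comp_left (g := Complex.re) rfl)
  have him := h (fun x => (φ x).im) (Complex.imCLM.contDiff.comp hφ)
    (hφc.comp_left (g := Complex.im) rfl)
  simp only [partialDeriv_re hφ, partialDeriv_im hφ] at hre him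
  have hd : ∀ i, ∫ x, partialDeriv i φ x * b i x = (∫ x, (partialDeriv i φ x).re • b i x)
      + Complex.I * ∫ x, (partialDeriv i φ x).im • b i x := fun i =>
    integral_mul_eq_re_add_im ((hφ.continuous_fderiv (by simp)).clm_apply continuous_const)
      (hφc.fderiv_apply ℝ _) (hb i)
  rw [integral_mul_eq_re_add_im hφ.continuous hφc ha]
  simp_rw [hd]
  rw [Finset.sum_add_distrib, ← Finset.mul_sum]
  linear_combination hre + Complex.I * him

theorem tendsto_integral_mul_of_bounded {κ : ℕ → RSpace d → ℝ} {k : RSpace d → ℝ} {C : ℝ}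
    (hκ : ∀ n, Continuous (κ n)) (hC : ∀ n x, |κ n x| ≤ C)
    (hlim : ∀ x, Tendsto (fun n => κ n x) atTop (𝓝 (k x))) {p c : RSpace d → ℂ}
    (hp : MemLp p 2 volume) (hc : MemLp c 2 volume) :
    Tendsto (fun n => ∫ x, (κ n x : ℂ) * p x * c x) atTop (𝓝 (∫ x, (k x : ℂ) * p x * c x)) := by
  have hint : Integrable (fun x => p x * c x) volume := MemLp.integrable_mul hp hc
  refine tendsto_integral_of_dominated_convergence (fun x => C * ‖p x * c x‖) (fun n => ?_)
    (hint.norm.const_mul C) (fun n => Eventually.of_forall fun x => ?_)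
    (Eventually.of_forall fun x => ?_)
  · exact ((Complex.continuous_ofReal.comp (hκ n)).aestronglyMeasurable.mul hp.1).mul hc.1
  · rw [mul_assoc, norm_mul, Complex.norm_real, Real.norm_eq_abs]
    gcongr
    exact hC n x
  · exact (((Complex.continuous_ofReal.tendsto _).comp (hlim x)).mul_const _).mul_const _

open LineDeriv in
/-- From test functions to Schwartz functions. -/
theorem schwartz_pairing_eq_zero {a : RSpace d → ℂ} {b : Fin d → RSpace d → ℂ}
    (ha : MemLp a 2 volume) (hb : ∀ i, MemLp (b i) 2 volume)
    (h : ∀ φ : RSpace d → ℝ, ContDiff ℝ ∞ φ → HasCompactSupport φ →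
      (∫ x, φ x • a x) + ∑ i, ∫ x, partialDeriv i φ x • b i x = 0) (ψ : 𝓢(RSpace d, ℂ)) :
    (∫ x, ψ x * a x)
      + ∑ i, ∫ x, (∂_{(EuclideanSpace.single i 1 : RSpace d)} ψ) x * b i x = 0 := by
  let χ : ContDiffBump (0 : RSpace d) := ⟨1, 2, one_pos, one_lt_two⟩
  have hχ : ContDiff ℝ ∞ χ := χ.contDiff
  have hχc : HasCompactSupport χ := χ.hasCompactSupport
  -- The cutoffs `χ (s n • x)` tend to `1` boundedly. The extra term of the product rule carries a
  -- factor `s n` and tends to `0` boundedly, so dominated convergence applies.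
  set s : ℕ → ℝ := fun n => ((n : ℝ) + 1)⁻¹ with hs
  have hs0 : ∀ n, 0 < s n := fun n => by positivity
  have hs1 : ∀ n, s n ≤ 1 := fun n => inv_le_one_of_one_le₀ (by
    have : (0 : ℝ) ≤ n := by positivity
    linarith)
  have hsl : Tendsto s atTop (𝓝 0) := tendsto_inv_atTop_zero.comp
    (tendsto_atTop_add_const_right _ _ tendsto_natCast_atTop_atTop)
  have hsc : ∀ n, Continuous fun x : RSpace d => s n • x := fun n => by fun_prop
  have hψ := ψ.smooth ⊤
  have hlin : ∀ n (x : RSpace d), HasFDerivAt (fun x : RSpace d => s n • x)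
      (s n • ContinuousLinearMap.id ℝ (RSpace d)) x := fun n x =>
    (hasFDerivAt_id x).const_smul (s n)
  have hφs : ∀ n, ContDiff ℝ ∞ fun x : RSpace d => (χ (s n • x) : ℂ) * ψ x := fun n =>
    (Complex.ofRealCLM.contDiff.comp (hχ.comp (contDiff_const_smul (s n)))).mul hψ
  have hφc : ∀ n, HasCompactSupport fun x : RSpace d => (χ (s n • x) : ℂ) * ψ x := fun n =>
    HasCompactSupport.mul_right ((hχc.comp_smul (hs0 n).ne').comp_left (g := Complex.ofReal) rfl)
  have hderiv : ∀ n i x, partialDeriv i (fun x : RSpace d => (χ (s n • x) : ℂ) * ψ x) x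
      = (χ (s n • x) : ℂ) * (∂_{(EuclideanSpace.single i 1 : RSpace d)} ψ) x
        + ((s n * partialDeriv i χ (s n • x) : ℝ) : ℂ) * ψ x := by
    intro n i x
    have h1 : HasFDerivAt (fun x : RSpace d => χ (s n • x))
        ((fderiv ℝ χ (s n • x)).comp (s n • ContinuousLinearMap.id ℝ (RSpace d))) x :=
      (hχ.differentiable (by simp) (s n • x)).hasFDerivAt.comp x (hlin n x)
    have h2 := (Complex.ofRealCLM.hasFDerivAt.comp x h1).mul
      (hψ.differentiable (by simp) x).hasFDerivAt
    unfold partialDeriv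
    have h3 : fderiv ℝ (fun x : RSpace d => (χ (s n • x) : ℂ) * ψ x) x = _ := h2.fderiv
    rw [h3, SchwartzMap.lineDerivOp_apply_eq_fderiv]
    simp
    ring
  obtain ⟨C, hC⟩ : ∃ C, ∀ i x, |partialDeriv i χ x| ≤ C := by
    have h1 : ∀ i, ∃ C, ∀ x, ‖partialDeriv i χ x‖ ≤ C := fun i =>
      (hasCompactSupport_partialDeriv hχc i).exists_bound_of_continuous
        (continuous_partialDeriv hχ i)
    choose C hC using h1
    refine ⟨∑ i, |C i|, fun i x => (hC i x).trans ((le_abs_self _).trans ?_)⟩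
    exact Finset.single_le_sum (f := fun i => |C i|) (fun i _ => abs_nonneg _) (Finset.mem_univ i)
  have hb1 : ∀ n x, |χ (s n • x)| ≤ 1 := fun n x => by
    rw [abs_of_nonneg χ.nonneg]; exact χ.le_one
  have hl1 : ∀ x : RSpace d, Tendsto (fun n => χ (s n • x)) atTop (𝓝 1) := by
    intro x
    have h1 : Tendsto (fun n => s n • x) atTop (𝓝 0) := by
      simpa using hsl.smul_const x
    refine tendsto_const_nhds.congr' ?_
    filter_upwards [h1 (χ.eventuallyEq_one)] with n hn
    exact hn.symm
  have hb2 : ∀ i n x, |s n * partialDeriv i χ (s n • x)| ≤ C := fun i n x => by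
    rw [abs_mul, abs_of_pos (hs0 n)]
    calc s n * |partialDeriv i χ (s n • x)| ≤ 1 * |partialDeriv i χ (s n • x)| := by
          gcongr; exact hs1 n
      _ ≤ C := by rw [one_mul]; exact hC i _
  have hl2 : ∀ i (x : RSpace d),
      Tendsto (fun n => s n * partialDeriv i χ (s n • x)) atTop (𝓝 0) := by
    intro i x
    refine squeeze_zero_norm (a := fun n => s n * C) (fun n => ?_) (by simpa using hsl.mul_const C)
    rw [norm_mul, Real.norm_eq_abs, abs_of_pos (hs0 n)]
    exact mul_le_mul_of_nonneg_left (hC i _) (hs0 n).le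
  have hc1 : ∀ n, Continuous fun x => χ (s n • x) := fun n => hχ.continuous.comp (hsc n)
  have hc2 : ∀ i n, Continuous fun x => s n * partialDeriv i χ (s n • x) := fun i n =>
    continuous_const.mul ((continuous_partialDeriv hχ i).comp (hsc n))
  have hψm : MemLp ψ 2 volume := ψ.memLp 2
  have hψim : ∀ i : Fin d,
      MemLp (∂_{(EuclideanSpace.single i 1 : RSpace d)} ψ : 𝓢(RSpace d, ℂ)) 2 volume :=
    fun i => SchwartzMap.memLp _ 2 volume
  have t1 := tendsto_integral_mul_of_bounded hc1 hb1 hl1 hψm ha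
  have t2 := fun i => tendsto_integral_mul_of_bounded hc1 hb1 hl1 (hψim i) (hb i)
  have t3 := fun i => tendsto_integral_mul_of_bounded (hc2 i) (hb2 i) (hl2 i) hψm (hb i)
  have hsplit : ∀ n i, ∫ x, partialDeriv i (fun x : RSpace d => (χ (s n • x) : ℂ) * ψ x) x * b i x
      = (∫ x, (χ (s n • x) : ℂ) * (∂_{(EuclideanSpace.single i 1 : RSpace d)} ψ) x * b i x)
        + ∫ x, ((s n * partialDeriv i χ (s n • x) : ℝ) : ℂ) * ψ x * b i x := by
    intro n i
    have hbd : ∀ (κ : RSpace d → ℝ) (D : ℝ) (p : RSpace d → ℂ), Continuous κ → (∀ x, |κ x| ≤ D) →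
        MemLp p 2 volume → Integrable (fun x => (κ x : ℂ) * p x * b i x) volume := by
      intro κ D p hκ hD hp
      simp_rw [mul_assoc]
      refine (MemLp.integrable_mul hp (hb i)).bdd_mul (c := D)
        (Complex.continuous_ofReal.comp hκ).aestronglyMeasurable
        (Eventually.of_forall fun x => ?_)
      rw [Complex.norm_real]
      exact hD x
    rw [← integral_add (hbd _ 1 _ (hc1 n) (hb1 n) (hψim i)) (hbd _ C _ (hc2 i n) (hb2 i n) hψm)]
    refine integral_congr_ae (Eventually.of_forall fun x => ?_)
    simp only [hderiv]
    ring
  have hlimit := t1.add (tendsto_finsetSum Finset.univ fun i _ => (t2 i).add (t3 i))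
  simp only [← hsplit] at hlimit
  have hzero := fun n => complex_pairing_eq_zero ha hb h (hφs n) (hφc n)
  simp only [hzero] at hlimit
  have := tendsto_nhds_unique hlimit tendsto_const_nhds
  simpa using this

open Laplacian in
/-- The equation `ψ - Δψ = g` is solvable in the Schwartz space. -/
theorem exists_schwartz_sub_laplacian_eq (g : 𝓢(RSpace d, ℂ)) :
    ∃ ψ : 𝓢(RSpace d, ℂ), ψ - Δ ψ = g := by
  set c : ℝ := 2 * Real.pi with hc
  -- The inverse of the Fourier symbol `1 + |2πξ|²` of `1 - Δ`; it has temperate growth, so it acts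
  -- on the Schwartz space.
  set w : RSpace d → ℂ := fun ξ => (((1 + ‖c • ξ‖ ^ 2) ^ (-1 : ℝ) : ℝ) : ℂ) with hw
  have hsm : Function.HasTemperateGrowth fun ξ : RSpace d => c • ξ := by fun_prop
  have hwt : w.HasTemperateGrowth := by
    have h1 := (Function.hasTemperateGrowth_one_add_norm_sq_rpow (RSpace d) (-1)).comp hsm
    exact Function.HasTemperateGrowth.comp (g := Complex.ofReal) (by fun_prop) h1
  have hn : Function.HasTemperateGrowth fun ξ : RSpace d => ((‖ξ‖ ^ 2 : ℝ) : ℂ) := by fun_prop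
  refine ⟨SchwartzMap.fourierMultiplierCLM ℂ w g, ?_⟩
  rw [SchwartzMap.laplacian_eq_fourierMultiplierCLM]
  have e1 : SchwartzMap.fourierMultiplierCLM ℂ (fun ξ : RSpace d => ‖ξ‖ ^ 2)
      (SchwartzMap.fourierMultiplierCLM ℂ w g)
      = SchwartzMap.fourierMultiplierCLM ℂ ((fun ξ : RSpace d => ((‖ξ‖ ^ 2 : ℝ) : ℂ)) * w) g := by
    rw [← SchwartzMap.fourierMultiplierCLM_fourierMultiplierCLM_apply hn hwt]
    exact (SchwartzMap.fourierMultiplierCLM_ofReal ℂ (by fun_prop) _).symm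
  have e2 : (fun ξ : RSpace d => ‖ξ‖ ^ 2) = (‖·‖ ^ 2) := rfl
  rw [← e2, e1]
  have e3 : SchwartzMap.fourierMultiplierCLM ℂ (fun _ : RSpace d => (1 : ℂ)) g = g := by
    rw [SchwartzMap.fourierMultiplierCLM_const]; simp
  conv_rhs => rw [← e3]
  simp only [SchwartzMap.fourierMultiplierCLM_apply]
  rw [neg_smul, sub_neg_eq_add, ← Complex.coe_smul, ← FourierTransform.fourierInv_smul,
    ← FourierTransform.fourierInv_add]
  congr 1
  ext ξ
  have hmt : Function.HasTemperateGrowth ((fun ξ : RSpace d => ((‖ξ‖ ^ 2 : ℝ) : ℂ)) * w) :=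
    hn.mul hwt
  rw [add_apply, smul_apply, SchwartzMap.smulLeftCLM_apply_apply hwt,
    SchwartzMap.smulLeftCLM_apply_apply hmt, SchwartzMap.smulLeftCLM_apply_apply (by fun_prop)]
  have e4 : w ξ + ((c ^ 2 : ℝ) : ℂ) * (((‖ξ‖ ^ 2 : ℝ) : ℂ) * w ξ) = 1 := by
    simp only [hw]
    rw [norm_smul, mul_pow, Real.norm_eq_abs, sq_abs, Real.rpow_neg_one]
    norm_cast
    have : (1 + c ^ 2 * ‖ξ‖ ^ 2) ≠ 0 := by positivity
    field_simp
  simp only [smul_eq_mul, Pi.mul_apply, one_mul]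
  linear_combination ((FourierTransform.fourier g) ξ) * e4

-- The hypotheses say `G = ∇f` and `f - div G = 0` weakly. Moving both derivatives to a Schwartz
-- function gives `∫ (ψ - Δψ) f = 0`, and `ψ - Δψ` can be any test function. So `f = 0`, and then `G
-- = 0`.
open LineDeriv Laplacian in
theorem ae_eq_zero_of_weak_helmholtz {f : RSpace d → ℂ} {G : Fin d → RSpace d → ℂ}
    (hf : MemLp f 2 volume) (hG : ∀ i, MemLp (G i) 2 volume)
    (h1 : ∀ φ : RSpace d → ℝ, ContDiff ℝ ∞ φ → HasCompactSupport φ → ∀ i,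
      ∫ x, partialDeriv i φ x • f x = - ∫ x, φ x • G i x)
    (h2 : ∀ φ : RSpace d → ℝ, ContDiff ℝ ∞ φ → HasCompactSupport φ →
      (∫ x, φ x • f x) + ∑ i, ∫ x, partialDeriv i φ x • G i x = 0) :
    (∀ᵐ x, f x = 0) ∧ ∀ i, ∀ᵐ x, G i x = 0 := by
  have k2 := schwartz_pairing_eq_zero hf hG h2
  have k1 : ∀ (i : Fin d) (ψ : 𝓢(RSpace d, ℂ)),
      ∫ x, (∂_{(EuclideanSpace.single i 1 : RSpace d)} ψ) x * f x = - ∫ x, ψ x * G i x := by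
    intro i ψ
    -- Taking `b` supported on the single index `i` turns the weak derivative identity into a
    -- pairing of the same shape, so it too extends to Schwartz functions.
    have := schwartz_pairing_eq_zero (a := G i) (b := fun k => if k = i then f else 0) (hG i)
      (fun k => by by_cases hk : k = i <;> simp [hk, hf]) (fun φ hφ hφc => by
        rw [Finset.sum_eq_single i (fun k _ hk => by simp [hk]) (by simp)]
        simp only [if_true]
        rw [h1 φ hφ hφc i, add_neg_cancel]) ψ
    rw [Finset.sum_eq_single i (fun k _ hk => by simp [hk]) (by simp)] at this
    simp only [if_true] at this
    linear_combination this
  have k3 : ∀ ψ : 𝓢(RSpace d, ℂ), ∫ x, (ψ - Δ ψ) x * f x = 0 := by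
    intro ψ
    have hint : ∀ χ : 𝓢(RSpace d, ℂ), Integrable (fun x => χ x * f x) volume := fun χ =>
      MemLp.integrable_mul (χ.memLp 2 volume) hf
    have e1 : ∫ x, (Δ ψ) x * f x = ∑ i, ∫ x, (∂_{(EuclideanSpace.single i 1 : RSpace d)}
        (∂_{(EuclideanSpace.single i 1 : RSpace d)} ψ : 𝓢(RSpace d, ℂ)) : 𝓢(RSpace d, ℂ)) x
          * f x := by
      rw [← integral_finsetSum _ fun i _ => hint _]
      refine integral_congr_ae (Eventually.of_forall fun x => ?_)
      simp only [SchwartzMap.laplacian_eq_sum (EuclideanSpace.basisFun (Fin d) ℝ),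
        EuclideanSpace.basisFun_apply]
      rw [sum_apply, Finset.sum_mul]
    have e2 : ∫ x, (ψ - Δ ψ) x * f x = (∫ x, ψ x * f x) - ∫ x, (Δ ψ) x * f x := by
      rw [← integral_sub (hint _) (hint _)]
      refine integral_congr_ae (Eventually.of_forall fun x => ?_)
      simp only [sub_apply, sub_mul]
    rw [e2, e1]
    simp_rw [k1]
    rw [Finset.sum_neg_distrib, sub_neg_eq_add]
    exact k2 ψ
  have hf0 : ∀ᵐ x, f x = 0 := by
    refine ae_eq_zero_of_integral_contDiff_smul_eq_zero (hf.locallyIntegrable one_le_two)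
      fun g hg hgc => ?_
    have hgc' : HasCompactSupport fun x => (g x : ℂ) := hgc.comp_left (g := Complex.ofReal) rfl
    obtain ⟨ψ, hψ⟩ := exists_schwartz_sub_laplacian_eq
      (hgc'.toSchwartzMap (Complex.ofRealCLM.contDiff.comp hg))
    have := k3 ψ
    rw [hψ] at this
    exact this
  refine ⟨hf0, fun i => ?_⟩
  refine ae_eq_zero_of_integral_contDiff_smul_eq_zero ((hG i).locallyIntegrable one_le_two)
    fun g hg hgc => ?_
  have e := h1 g hg hgc i
  rw [integral_eq_zero_of_ae (by filter_upwards [hf0] with x hx; simp [hx])] at e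
  simpa using e.symm

/-- Test functions are dense in `H¹(ℝ^d)`. -/
theorem H1_univ_le_closure_testPairs :
    H1 (univ : Set (RSpace d)) ≤ (testPairs (univ : Set (RSpace d))).topologicalClosure := by
  intro p hp
  set Q := (testPairs (univ : Set (RSpace d))).topologicalClosure with hQ
  have hQH : Q ≤ H1 univ := Submodule.topologicalClosure_minimal _ testPairs_le_H1 isClosed_H1
  have hQc : CompleteSpace Q := (testPairs univ).isClosed_topologicalClosure.completeSpace_coe
  -- The orthogonal part `r` still lies in `H¹`. Orthogonality to all `(φ, ∇φ)` is the weak equation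
  -- `f - Δf = 0`, which forces `r = 0`.
  obtain ⟨q, hq, r, hr, rfl⟩ := Q.exists_add_mem_mem_orthogonal p
  have hrH : r ∈ H1 univ := by
    have := (H1 univ).sub_mem hp (hQH hq)
    simpa using this
  have hf : MemLp r.fst 2 volume := by
    have := Lp.memLp r.fst
    simpa only [Measure.restrict_univ] using this
  have hG : MemLp r.snd 2 volume := by
    have := Lp.memLp r.snd
    simpa only [Measure.restrict_univ] using this
  have key := ae_eq_zero_of_weak_helmholtz (f := r.fst) (G := fun i x => r.snd x i) hf
    (fun i => memLp_coord hG i) (fun φ hφ hφc i => by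
      have := hrH φ hφ hφc (subset_univ _) i
      simpa only [Measure.restrict_univ] using this) (fun φ hφ hφc => ?_)
  · have hr0 : r = 0 := by
      have e1 : r.fst = 0 := by
        rw [Lp.eq_zero_iff_ae_eq_zero]
        exact ae_restrict_of_ae key.1
      have e2 : r.snd = 0 := by
        rw [Lp.eq_zero_iff_ae_eq_zero]
        filter_upwards [ae_restrict_of_ae (ae_all_iff.2 key.2)] with x hx
        ext i
        exact hx i
      refine (WithLp.ofLp_injective 2) (Prod.ext e1 e2)
    rw [hr0, add_zero]
    exact hq
  · have hφs : ContDiff ℝ ∞ fun x => (φ x : ℂ) := Complex.ofRealCLM.contDiff.comp hφ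
    have hφsc : HasCompactSupport fun x => (φ x : ℂ) := hφc.comp_left (g := Complex.ofReal) rfl
    have m1 := memLp_of_contDiff (U := univ) hφs hφsc
    have m2 := memLp_classicalGrad (U := univ) hφs hφsc
    have hin : WithLp.toLp 2 (m1.toLp _, m2.toLp _) ∈ Q :=
      Submodule.le_topologicalClosure _ ⟨_, hφs, hφsc, m1.coeFn_toLp, m2.coeFn_toLp⟩
    have h0 := (Q.mem_orthogonal r).1 hr _ hin
    rw [WithLp.prod_inner_apply] at h0
    change inner ℂ (m1.toLp _) r.fst + inner ℂ (m2.toLp _) r.snd = 0 at h0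
    rw [L2.inner_def, L2.inner_def] at h0
    have hpd : ∀ x i, classicalGrad (fun x => (φ x : ℂ)) x i = ((partialDeriv i φ x : ℝ) : ℂ) := by
      intro x i
      have h := Complex.ofRealCLM.hasFDerivAt.comp x
        (hφ.differentiable (by simp) x).hasFDerivAt
      have h' : fderiv ℝ (fun x => (φ x : ℂ)) x = _ := h.fderiv
      simp only [classicalGrad, partialDeriv, h']
      rfl
    have e1 : ∫ x in univ, inner ℂ (m1.toLp (fun x => (φ x : ℂ)) x) (r.fst x)
        = ∫ x, φ x • r.fst x := by
      refine Eq.trans (integral_congr_ae ?_) setIntegral_univ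
      filter_upwards [m1.coeFn_toLp] with x hx
      rw [hx, RCLike.inner_apply, Complex.conj_ofReal, mul_comm, Complex.real_smul]
    have e2 : ∫ x in univ, inner ℂ (m2.toLp (classicalGrad fun x => (φ x : ℂ)) x) (r.snd x)
        = ∑ i, ∫ x, partialDeriv i φ x • r.snd x i := by
      rw [← integral_finsetSum _ fun i _ => integrable_smul_of_memLp
        (continuous_partialDeriv hφ i) (hasCompactSupport_partialDeriv hφc i) (memLp_coord hG i)]
      refine Eq.trans (integral_congr_ae ?_) setIntegral_univ
      filter_upwards [m2.coeFn_toLp] with x hx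
      rw [hx, PiLp.inner_apply]
      refine Finset.sum_congr rfl fun i _ => ?_
      rw [hpd, RCLike.inner_apply, Complex.conj_ofReal, mul_comm, Complex.real_smul]
    rw [e1, e2] at h0
    exact h0

end Density

/-! ### Form domains, existence and uniqueness of traces, and extensions -/

section TraceOperator

variable {d : ℕ} {U S Ω : Set (RSpace d)}

/-- The trace graph as a Hilbert space. -/
def TraceDomain (U S : Set (RSpace d)) : Type := traceGraph U S

noncomputable instance : NormedAddCommGroup (TraceDomain U S) :=
  inferInstanceAs (NormedAddCommGroup (traceGraph U S))

noncomputable instance : InnerProductSpace ℂ (TraceDomain U S) :=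
  inferInstanceAs (InnerProductSpace ℂ (traceGraph U S))

instance : CompleteSpace (TraceDomain U S) :=
  inferInstanceAs (CompleteSpace (traceGraph U S))

/-- The inclusion of the trace graph in the ambient Hilbert space. -/
noncomputable def traceDomainIncl (U S : Set (RSpace d)) :
    TraceDomain U S →L[ℂ] WithLp 2 (WithLp 2 (L2 U × L2Vec U) × L2Surf S) :=
  (traceGraph U S).subtypeL

/-- The `L²` function of an element of the trace graph. -/
noncomputable def traceGraphFn (U S : Set (RSpace d)) : TraceDomain U S →L[ℂ] L2 U :=
  ContinuousLinearMap.fst ℂ _ _ ∘L (WithLp.prodContinuousLinearEquiv 2 ℂ (L2 U) (L2Vec U)).toContinuousLinearMap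
    ∘L ContinuousLinearMap.fst ℂ _ _
    ∘L (WithLp.prodContinuousLinearEquiv 2 ℂ (WithLp 2 (L2 U × L2Vec U)) (L2Surf S)).toContinuousLinearMap
    ∘L traceDomainIncl U S

/-- The weak gradient of an element of the trace graph. -/
noncomputable def traceGraphGrad (U S : Set (RSpace d)) : TraceDomain U S →L[ℂ] L2Vec U :=
  ContinuousLinearMap.snd ℂ _ _ ∘L (WithLp.prodContinuousLinearEquiv 2 ℂ (L2 U) (L2Vec U)).toContinuousLinearMap
    ∘L ContinuousLinearMap.fst ℂ _ _
    ∘L (WithLp.prodContinuousLinearEquiv 2 ℂ (WithLp 2 (L2 U × L2Vec U)) (L2Surf S)).toContinuousLinearMap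
    ∘L traceDomainIncl U S

/-- The trace of an element of the trace graph. -/
noncomputable def traceGraphTrace (U S : Set (RSpace d)) : TraceDomain U S →L[ℂ] L2Surf S :=
  ContinuousLinearMap.snd ℂ _ _
    ∘L (WithLp.prodContinuousLinearEquiv 2 ℂ (WithLp 2 (L2 U × L2Vec U)) (L2Surf S)).toContinuousLinearMap
    ∘L traceDomainIncl U S

theorem traceGraphFn_apply (k : TraceDomain U S) : traceGraphFn U S k = k.1.fst.fst := rfl

theorem traceGraphGrad_apply (k : TraceDomain U S) : traceGraphGrad U S k = k.1.fst.snd := rfl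

theorem traceGraphTrace_apply (k : TraceDomain U S) : traceGraphTrace U S k = k.1.snd := rfl

theorem norm_sq_traceGraph (k : TraceDomain U S) :
    ‖k‖ ^ 2 = ‖traceGraphFn U S k‖ ^ 2 + ‖traceGraphGrad U S k‖ ^ 2
      + ‖traceGraphTrace U S k‖ ^ 2 := by
  rw [traceGraphFn_apply, traceGraphGrad_apply, traceGraphTrace_apply,
    ← WithLp.prod_norm_sq_eq_of_L2, ← WithLp.prod_norm_sq_eq_of_L2]
  rfl

theorem norm_sq_H1 (f : H1 U) : ‖f‖ ^ 2 = ‖fn f‖ ^ 2 + ‖grad f‖ ^ 2 :=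
  WithLp.prod_norm_sq_eq_of_L2 f.1

/-- Functions paired with a trace are exactly the points of the trace graph, so the concrete
operator has the abstract form treated above. -/
theorem mem_formOperatorGraph_iff {γ : ℝ} (p : L2 U × L2 U) :
    p ∈ formOperatorGraph U S γ ↔ ∃ k : TraceDomain U S, traceGraphFn U S k = p.1 ∧
      ∀ l : TraceDomain U S, inner ℂ (traceGraphGrad U S l) (traceGraphGrad U S k)
        - (γ : ℂ) * inner ℂ (traceGraphTrace U S l) (traceGraphTrace U S k)
        = inner ℂ (traceGraphFn U S l) p.2 := by
  constructor
  · rintro ⟨f, u, hfu, hf, hg⟩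
    refine ⟨⟨_, isTrace_iff.1 hfu⟩, hf, fun l => ?_⟩
    exact hg ⟨l.1.fst, fst_mem_H1_of_mem_traceGraph l.2⟩ l.1.snd (isTrace_iff.2 l.2)
  · rintro ⟨k, hk, hl⟩
    refine ⟨⟨k.1.fst, fst_mem_H1_of_mem_traceGraph k.2⟩, k.1.snd, isTrace_iff.2 k.2, hk,
      fun g v hgv => ?_⟩
    exact hl ⟨_, isTrace_iff.1 hgv⟩

theorem ofReal_norm_sq_eq_lintegral {E : Type*} [NormedAddCommGroup E] {μ : Measure (RSpace d)}
    (f : Lp E 2 μ) {g : RSpace d → E} (h : f =ᵐ[μ] g) :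
    ENNReal.ofReal (‖f‖ ^ 2) = ∫⁻ x, ‖g x‖ₑ ^ 2 ∂μ := by
  rw [ENNReal.ofReal_pow (norm_nonneg _), ofReal_norm, Lp.enorm_def, eLpNorm_congr_ae h]
  have := eLpNorm_nnreal_pow_eq_lintegral (f := g) (μ := μ) (p := 2) two_ne_zero
  simpa using this

/-- The trace of test functions is bounded relative to the gradient on `U`, with relative
bound `0`. -/
def HasTraceInequality (U S : Set (RSpace d)) : Prop :=
  ∀ δ : ℝ, 0 < δ → ∃ C : ℝ, 0 ≤ C ∧ ∀ φ : RSpace d → ℂ, ContDiff ℝ 1 φ →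
    ∫⁻ x, ‖φ x‖ₑ ^ 2 ∂(surfaceMeasure S)
      ≤ ENNReal.ofReal δ * (∫⁻ x in U, ‖classicalGrad φ x‖ₑ ^ 2)
        + ENNReal.ofReal C * ∫⁻ x in U, ‖φ x‖ₑ ^ 2

/-- This carries the inequality from `Ω` to `ℝ^d`, so the `δ`-interaction needs no separate estimate
from the other side of the boundary. -/
theorem HasTraceInequality.mono {V : Set (RSpace d)} (h : HasTraceInequality U S) (hUV : U ⊆ V) :
    HasTraceInequality V S := by
  intro δ hδ
  obtain ⟨C, hC0, hC⟩ := h δ hδ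
  refine ⟨C, hC0, fun φ hφ => (hC φ hφ).trans ?_⟩
  gcongr

/-- The inequality is a closed condition that holds on test triples, so it passes to their closure.
-/
theorem HasTraceInequality.norm_trace_sq_le (h : HasTraceInequality U S) (δ : ℝ) (hδ : 0 < δ) :
    ∃ C : ℝ, ∀ k : TraceDomain U S, ‖traceGraphTrace U S k‖ ^ 2
      ≤ δ * ‖traceGraphGrad U S k‖ ^ 2 + C * ‖traceGraphFn U S k‖ ^ 2 := by
  obtain ⟨C, hC0, hC⟩ := h δ hδ
  refine ⟨C, fun k => ?_⟩
  have hc : IsClosed {p : WithLp 2 (WithLp 2 (L2 U × L2Vec U) × L2Surf S) |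
      ‖p.snd‖ ^ 2 ≤ δ * ‖p.fst.snd‖ ^ 2 + C * ‖p.fst.fst‖ ^ 2} := by
    have c0 : Continuous fun p : WithLp 2 (WithLp 2 (L2 U × L2Vec U) × L2Surf S) => p.fst :=
      (WithLp.prod_continuous_ofLp 2 _ _).fst
    have c1 : Continuous fun p : WithLp 2 (WithLp 2 (L2 U × L2Vec U) × L2Surf S) => p.snd :=
      (WithLp.prod_continuous_ofLp 2 _ _).snd
    have c2 : Continuous fun p : WithLp 2 (WithLp 2 (L2 U × L2Vec U) × L2Surf S) => p.fst.fst :=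
      (WithLp.prod_continuous_ofLp 2 _ _).fst.comp c0
    have c3 : Continuous fun p : WithLp 2 (WithLp 2 (L2 U × L2Vec U) × L2Surf S) => p.fst.snd :=
      (WithLp.prod_continuous_ofLp 2 _ _).snd.comp c0
    exact isClosed_le (by fun_prop) (by fun_prop)
  refine closure_minimal ?_ hc k.2
  rintro p ⟨φ, h1, -, h3, h4, h5⟩
  have := hC φ (h1.of_le (by simp))
  rw [← ofReal_norm_sq_eq_lintegral _ h3, ← ofReal_norm_sq_eq_lintegral _ h4,
    ← ofReal_norm_sq_eq_lintegral _ h5, ← ENNReal.ofReal_mul hδ.le, ← ENNReal.ofReal_mul hC0,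
    ← ENNReal.ofReal_add (by positivity) (by positivity),
    ENNReal.ofReal_le_ofReal_iff (by positivity)] at this
  exact this

theorem HasTraceInequality.memLp (h : HasTraceInequality U S) {φ : RSpace d → ℂ}
    (h1 : ContDiff ℝ ∞ φ) (h2 : HasCompactSupport φ) : MemLp φ 2 (surfaceMeasure S) := by
  refine ⟨h1.continuous.aestronglyMeasurable, ?_⟩
  obtain ⟨C, -, hC⟩ := h 1 one_pos
  have h3 := hC φ (h1.of_le (by simp))
  rw [← ofReal_norm_sq_eq_lintegral _ (memLp_of_contDiff (U := U) h1 h2).coeFn_toLp,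
    ← ofReal_norm_sq_eq_lintegral _ (memLp_classicalGrad (U := U) h1 h2).coeFn_toLp] at h3
  have h4 : eLpNorm φ 2 (surfaceMeasure S) ^ 2 = ∫⁻ x, ‖φ x‖ₑ ^ 2 ∂(surfaceMeasure S) := by
    have := eLpNorm_nnreal_pow_eq_lintegral (f := φ) (μ := surfaceMeasure S) (p := 2) two_ne_zero
    simpa using this
  rw [← h4] at h3
  have h5 := h3.trans_lt (ENNReal.add_lt_top.2 ⟨ENNReal.mul_lt_top ENNReal.ofReal_lt_top
    ENNReal.ofReal_lt_top, ENNReal.mul_lt_top ENNReal.ofReal_lt_top ENNReal.ofReal_lt_top⟩)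
  by_contra h6
  rw [not_lt_top_iff] at h6
  rw [h6] at h5
  simp at h5

/-- If all traces vanished, so would those of bump functions equal to `1` on arbitrarily large
balls, making `S` a null set. -/
theorem HasTraceInequality.traceGraphTrace_ne_zero (h : HasTraceInequality U S)
    (hS : surfaceMeasure S univ ≠ 0) : traceGraphTrace U S ≠ 0 := by
  intro h0
  apply hS
  rw [← Metric.iUnion_ball_nat (0 : RSpace d), measure_iUnion_null_iff]
  intro n
  let χ : ContDiffBump (0 : RSpace d) :=
    ⟨n + 1, n + 2, by positivity, by linarith⟩
  have h1 : ContDiff ℝ ∞ fun x => (χ x : ℂ) := Complex.ofRealCLM.contDiff.comp χ.contDiff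
  have h2 : HasCompactSupport fun x => (χ x : ℂ) :=
    χ.hasCompactSupport.comp_left (g := Complex.ofReal) rfl
  have m1 := memLp_of_contDiff (U := U) h1 h2
  have m2 := memLp_classicalGrad (U := U) h1 h2
  have m3 := h.memLp h1 h2
  have hmem : WithLp.toLp 2 (WithLp.toLp 2 (m1.toLp _, m2.toLp _), m3.toLp _) ∈ traceGraph U S :=
    Submodule.le_topologicalClosure _ ⟨_, h1, h2, m1.coeFn_toLp, m2.coeFn_toLp, m3.coeFn_toLp⟩
  have h3 : m3.toLp _ = 0 := congrArg (fun T => T ⟨_, hmem⟩) h0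
  rw [Lp.eq_zero_iff_ae_eq_zero] at h3
  have h4 := m3.coeFn_toLp.symm.trans h3
  refine measure_mono_null (fun x hx => ?_) h4
  have : χ x = 1 := χ.one_of_mem_closedBall (by
    rw [mem_ball_zero_iff] at hx
    rw [mem_closedBall_zero_iff]
    change ‖x‖ ≤ n + 1
    linarith)
  simp [this]

/-- Every element of `H¹(ℝ^d)` has a trace. -/
theorem HasTraceInequality.exists_isTrace (h : HasTraceInequality univ S)
    (f : H1 (univ : Set (RSpace d))) : ∃ u, IsTrace univ S f u := by
  obtain ⟨C, hC⟩ := h.norm_trace_sq_le 1 one_pos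
  set P : TraceDomain univ S →L[ℂ] WithLp 2 (L2 (univ : Set (RSpace d)) × L2Vec univ) :=
    ContinuousLinearMap.fst ℂ _ _
    ∘L (WithLp.prodContinuousLinearEquiv 2 ℂ (WithLp 2 (L2 univ × L2Vec univ))
      (L2Surf S)).toContinuousLinearMap ∘L traceDomainIncl univ S with hP
  have hPn : ∀ k, ‖P k‖ ^ 2 = ‖traceGraphFn univ S k‖ ^ 2 + ‖traceGraphGrad univ S k‖ ^ 2 :=
    fun k => WithLp.prod_norm_sq_eq_of_L2 (P k)
  -- The trace inequality bounds the trace by the `H¹` part, so forgetting the trace is bounded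
  -- below and has closed range. That range contains the test pairs, hence by density all of
  -- `H¹(ℝ^d)`.
  have hanti : AntilipschitzWith (Real.toNNReal (2 + |C|)) P := by
    refine P.antilipschitz_of_bound fun k => ?_
    rw [Real.coe_toNNReal _ (by positivity)]
    refine (pow_le_pow_iff_left₀ (by positivity) (by positivity) two_ne_zero).1 ?_
    rw [mul_pow, hPn, norm_sq_traceGraph]
    have h1 := hC k
    have h2 : C * ‖traceGraphFn univ S k‖ ^ 2 ≤ |C| * ‖traceGraphFn univ S k‖ ^ 2 := by
      gcongr; exact le_abs_self C
    have h3 : (2 + |C|) ≤ (2 + |C|) ^ 2 := by nlinarith [abs_nonneg C]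
    have h4 : (2 + |C|) * (‖traceGraphFn univ S k‖ ^ 2 + ‖traceGraphGrad univ S k‖ ^ 2)
        ≤ (2 + |C|) ^ 2 * (‖traceGraphFn univ S k‖ ^ 2 + ‖traceGraphGrad univ S k‖ ^ 2) := by
      gcongr
    have h5 : 0 ≤ |C| * ‖traceGraphGrad univ S k‖ ^ 2 := by positivity
    nlinarith [sq_nonneg ‖traceGraphFn univ S k‖]
  have hcl : IsClosed (range P) := hanti.isClosed_range P.uniformContinuous
  have hsub : (testPairs (univ : Set (RSpace d)) : Set _) ⊆ range P := by
    rintro p ⟨φ, h1, h2, h3, h4⟩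
    have m := h.memLp h1 h2
    have hmem : WithLp.toLp 2 (p, m.toLp φ) ∈ traceGraph univ S :=
      Submodule.le_topologicalClosure _ ⟨φ, h1, h2, h3, h4, m.coeFn_toLp⟩
    exact ⟨⟨_, hmem⟩, rfl⟩
  obtain ⟨k, hk⟩ := closure_minimal hsub hcl (H1_univ_le_closure_testPairs f.2)
  refine ⟨k.1.snd, isTrace_iff.2 ?_⟩
  rw [← hk]
  exact k.2

theorem isWeakGrad_of_univ {f : RSpace d → ℂ} {G : RSpace d → EuclideanSpace ℂ (Fin d)}
    (h : IsWeakGrad univ f G) : IsWeakGrad U f G := by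
  intro φ h1 h2 h3 i
  have := h φ h1 h2 (subset_univ _) i
  rw [Measure.restrict_univ] at this
  rw [setIntegral_eq_integral_of_forall_compl_eq_zero, this,
    setIntegral_eq_integral_of_forall_compl_eq_zero]
  · intro x hx
    rw [image_eq_zero_of_notMem_tsupport fun hx' => hx (h3 hx'), zero_smul]
  · intro x hx
    have : fderiv ℝ φ x = 0 :=
      image_eq_zero_of_notMem_tsupport fun hx' => hx (h3 (tsupport_fderiv_subset ℝ hx'))
    simp [partialDeriv, this]

/-- The fundamental lemma of the calculus of variations, applied to each coordinate of `G - G'`. -/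
theorem isWeakGrad_unique (hU : IsOpen U) {f : RSpace d → ℂ}
    {G G' : RSpace d → EuclideanSpace ℂ (Fin d)} (hG : MemLp G 2 (volume.restrict U))
    (hG' : MemLp G' 2 (volume.restrict U)) (h : IsWeakGrad U f G) (h' : IsWeakGrad U f G') :
    G =ᵐ[volume.restrict U] G' := by
  have key : ∀ i, ∀ᵐ x ∂(volume.restrict U), G x i - G' x i = 0 := by
    intro i
    have hm := memLp_coord hG i
    have hm' := memLp_coord hG' i
    have := hU.ae_eq_zero_of_integral_contDiff_smul_eq_zero (μ := volume.restrict U)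
      (f := fun x => G x i - G' x i)
      (((hm.sub hm').locallyIntegrable one_le_two).locallyIntegrableOn U)
      (fun φ h1 h2 h3 => by
        simp_rw [smul_sub]
        rw [integral_sub (integrable_smul_of_memLp h1.continuous h2 hm)
          (integrable_smul_of_memLp h1.continuous h2 hm')]
        have e1 := h φ h1 h2 h3 i
        have e2 := h' φ h1 h2 h3 i
        linear_combination e1 - e2)
    filter_upwards [this, ae_restrict_mem hU.measurableSet] with x hx hxU
    exact hx hxU
  filter_upwards [ae_all_iff.2 key] with x hx
  ext i
  exact sub_eq_zero.1 (hx i)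

/-- An extension operator prescribes only the function on `Ω`; the gradients agree there because
weak gradients on an open set are unique. -/
theorem IsExtensionOperator.grad_ae_eq (hΩ : IsOpen Ω) {E : H1 Ω →L[ℂ] H1 (univ : Set (RSpace d))}
    (hE : IsExtensionOperator E) (f : H1 Ω) : grad (E f) =ᵐ[volume.restrict Ω] grad f := by
  have hle : volume.restrict Ω ≤ volume.restrict (univ : Set (RSpace d)) :=
    Measure.restrict_mono (subset_univ _) le_rfl
  exact isWeakGrad_unique hΩ ((Lp.memLp _).mono_measure hle) (Lp.memLp _)
    (isWeakGrad_congr (hE f) EventuallyEq.rfl (isWeakGrad_of_univ (E f).2)) f.2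

/-- The trace of an extension is a trace of the function itself. -/
theorem IsExtensionOperator.isTrace (hΩ : IsOpen Ω) {E : H1 Ω →L[ℂ] H1 (univ : Set (RSpace d))}
    (hE : IsExtensionOperator E) {f : H1 Ω} {u : L2Surf S} (h : IsTrace univ S (E f) u) :
    IsTrace Ω S f u := by
  intro ε hε
  obtain ⟨φ, h1, h2, h3, h4, h5⟩ := h ε hε
  have hle : volume.restrict Ω ≤ volume.restrict (univ : Set (RSpace d)) :=
    Measure.restrict_mono (subset_univ _) le_rfl
  refine ⟨φ, h1, h2, ?_, ?_, h5⟩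
  · refine le_trans (le_of_eq (eLpNorm_congr_ae ?_)) ((eLpNorm_mono_measure _ hle).trans h3)
    filter_upwards [hE f] with x hx
    rw [hx]
  · refine le_trans (le_of_eq (eLpNorm_congr_ae ?_)) ((eLpNorm_mono_measure _ hle).trans h4)
    filter_upwards [hE.grad_ae_eq hΩ f] with x hx
    rw [hx]

/-- The difference of two traces of `f` is a trace of `0`, and the trace inequality makes it vanish.
-/
theorem HasTraceInequality.isTrace_unique (h : HasTraceInequality U S) {f : H1 U}
    {u v : L2Surf S} (hu : IsTrace U S f u) (hv : IsTrace U S f v) : u = v := by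
  have hmem := (traceGraph U S).sub_mem (isTrace_iff.1 hu) (isTrace_iff.1 hv)
  obtain ⟨C, hC⟩ := h.norm_trace_sq_le 1 one_pos
  have := hC ⟨_, hmem⟩
  change ‖u - v‖ ^ 2 ≤ 1 * ‖f.1.snd - f.1.snd‖ ^ 2 + C * ‖f.1.fst - f.1.fst‖ ^ 2 at this
  rw [sub_self, sub_self, norm_zero, norm_zero, zero_pow two_ne_zero, mul_zero, mul_zero,
    add_zero] at this
  have h0 : ‖u - v‖ = 0 := by
    have h2 := le_antisymm this (sq_nonneg _)
    exact pow_eq_zero_iff two_ne_zero |>.1 h2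
  exact sub_eq_zero.1 (norm_eq_zero.1 h0)

/-- The couplings `γ` for which `‖∇f‖² - γ ‖f|_S‖² ≥ -‖f‖²` for all `f` in the form domain. -/
noncomputable def traceCouplings (U S : Set (RSpace d)) : Set ℝ :=
  admissibleCouplings (H := L2 U) (G := L2Vec U) (S := L2Surf S) (K := TraceDomain U S)
    (traceGraphFn U S) (traceGraphGrad U S) (traceGraphTrace U S)

/-- The couplings `γ > 0` for which the bottom of the spectrum is `-1`. -/
theorem HasTraceInequality.bottomSpectrum_eq_neg_one_iff (h : HasTraceInequality U S)
    (hS : surfaceMeasure S univ ≠ 0) {γ : ℝ} (hγ : 0 < γ) :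
    bottomSpectrum (formOperatorGraph U S γ) = -1 ↔ 
      IsGreatest (traceCouplings U S) γ :=
  SobolevExtension.bottomSpectrum_eq_neg_one_iff (H := L2 U) (G := L2Vec U) (S := L2Surf S)
    (K := TraceDomain U S) norm_sq_traceGraph h.norm_trace_sq_le
    (h.traceGraphTrace_ne_zero hS) hγ mem_formOperatorGraph_iff

theorem HasTraceInequality.existsUnique_bottomSpectrum_eq_neg_one (h : HasTraceInequality U S)
    (hS : surfaceMeasure S univ ≠ 0) :
    ∃! γ : ℝ, 0 < γ ∧ bottomSpectrum (formOperatorGraph U S γ) = -1 := by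
  obtain ⟨γ, hγ, hgr⟩ := exists_isGreatest_admissibleCouplings (H := L2 U) (G := L2Vec U)
    (S := L2Surf S) (K := TraceDomain U S) h.norm_trace_sq_le
    (h.traceGraphTrace_ne_zero hS)
  refine ⟨γ, ⟨hγ, (h.bottomSpectrum_eq_neg_one_iff hS hγ).2 hgr⟩, fun γ' hγ' => ?_⟩
  exact ((h.bottomSpectrum_eq_neg_one_iff hS hγ'.1).1 hγ'.2).unique hgr

end TraceOperator

end SobolevExtension

/-! ### The lower bound for extension operators -/

theorem mainTheorem2 (d : ℕ) (hd : 2 ≤ d) (Ω : Set (SobolevExtension.RSpace d))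
    (hΩ : SobolevExtension.IsLipschitzDomain Ω) (hne : Ω ≠ univ) :
    (∃! β : ℝ, 0 < β ∧ SobolevExtension.robinBottom Ω β = -1) ∧
    (∃! α : ℝ, 0 < α ∧ SobolevExtension.deltaBottom Ω α = -1) ∧
    ∀ α β : ℝ, 0 < α → SobolevExtension.deltaBottom Ω α = -1 →
      0 < β → SobolevExtension.robinBottom Ω β = -1 →
      ENNReal.ofReal (Real.sqrt (α / β)) ≤ SobolevExtension.minExtensionNorm Ω := by
  have hS := hΩ.surfaceMeasure_frontier_ne_zero hne
  have h1 : SobolevExtension.HasTraceInequality Ω (frontier Ω) := fun δ hδ =>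
    hΩ.trace_inequality hδ
  have h2 : SobolevExtension.HasTraceInequality univ (frontier Ω) := h1.mono (subset_univ Ω)
  refine ⟨h1.existsUnique_bottomSpectrum_eq_neg_one hS,
    h2.existsUnique_bottomSpectrum_eq_neg_one hS, fun α β hα hα1 hβ hβ1 => ?_⟩
  refine le_iInf₂ fun E hE => ?_
  rw [← ofReal_norm]
  refine ENNReal.ofReal_le_ofReal (Real.sqrt_le_iff.2 ⟨norm_nonneg _, ?_⟩)
  -- The comparison is used with loss factor `‖E‖²`: a form element on `Ω` is sent to its extension
  -- by `E`.
  refine SobolevExtension.critical_coupling_le_mul hα hβ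
    ((SobolevExtension.HasTraceInequality.bottomSpectrum_eq_neg_one_iff h2 hS hα).1 hα1)
    ((SobolevExtension.HasTraceInequality.bottomSpectrum_eq_neg_one_iff h1 hS hβ).1 hβ1) (sq_nonneg _) fun k' => ?_
  set f : SobolevExtension.H1 Ω :=
    ⟨k'.1.fst, SobolevExtension.fst_mem_H1_of_mem_traceGraph k'.2⟩ with hf
  have hk' : SobolevExtension.IsTrace Ω (frontier Ω) f k'.1.snd :=
    SobolevExtension.isTrace_iff.2 k'.2
  obtain ⟨w, hw⟩ := h2.exists_isTrace (E f)
  -- The trace of `E f` taken from `ℝ^d` is also a trace of `f` from `Ω`, so uniqueness identifies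
  -- it with the given one.
  have hwu : w = k'.1.snd := h1.isTrace_unique (hE.isTrace hΩ.1 hw) hk'
  refine ⟨⟨_, SobolevExtension.isTrace_iff.1 hw⟩, hwu, ?_⟩
  have h3 : ‖E f‖ ^ 2 ≤ ‖E‖ ^ 2 * ‖f‖ ^ 2 := by
    rw [← mul_pow]
    gcongr
    exact E.le_opNorm f
  rw [SobolevExtension.norm_sq_H1, SobolevExtension.norm_sq_H1,
    add_comm (‖SobolevExtension.fn (E f)‖ ^ 2), add_comm (‖SobolevExtension.fn f‖ ^ 2)] at h3
  exact h3
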